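/- For $i=1,2$ let $\mathcal G_i$ be a set of natural numbers that are pairwise coprime, and let $\mathcal H_i$ be a finite set of integers. For $g\in\mathcal G_i$ let $\nu_g(\mathcal H_i)$ be the number of residue classes modulo $g$ occupied by the elements of $\mathcal H_i$, and assume that $\mathcal H_i$ is admissible: $\nu_g(\mathcal H_i)<g$ for all $g\in\mathcal G_i$. Let $$\mathcal V_i=\{n\in\mathbb N:\ n\not\equiv h\ (\mathrm{mod}\ g)\ \text{ for all } h\in\mathcal H_i,\ g\in\mathcal G_i\},\qquad \mathcal V^3=\{(m,n)\in\mathbb N^2:\ m\in\mathcal V_1,\ n\in\mathcal V_2,\ \gcd(m,n)=1\}.$$ Let $\mathcal A^i$ be the set of all products of finitely many distinct elements of $\mathcal G_i$ (including the empty product $1$), and for a constant $A$ let $\mathcal A^i_x=\{a\in\mathcal A^i: a\le x^A\}$. Assume that, for some constants $A\ge 1$, $0<\varepsilon<1$ and some $\theta_1,\theta_2\in(0,1)$, the sets $\mathcal A^i_x$ satisfy Condition A with $\theta=\theta_i$: for all sufficiently large $x$, $a\ll x^A$ for $a\in\mathcal A^i_x$, and $|\mathcal A^i_x\cap[1,y]|\ll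 y^{\theta_i}/\log^A y$ for all $y\ge x^{\varepsilon}$, with implied constants independent of $x$, $a$ and $y$. Put $$c_i=\prod_{g\in\mathcal G_i}\Big(1-\frac{\nu_g(\mathcal H_i)}{g}\Big)\quad(i=1,2),\qquad c_3=\sum_{r\ge1}\frac{\mu(r)}{r^2}f_1(r)f_2(r),$$ $$f_i(r)=\prod_{\substack{g\in\mathcal G_i\\ (g,r)>1}}\Big(1-\frac{\nu_g(\mathcal H_i)}{g}\Big)^{-1}\sum_{d} d\,\omega_i(d),\qquad \omega_i(d)=\prod_{\substack{g\in\mathcal G_i\\ (g,d)>1}}\frac{-\kappa_{i,g}((g,d))}{g},$$ where $d$ runs over the divisors of $\big(r,\prod_{h\in\mathcal H_i}h\big)$ that have the form $d=(r,a)$ with $a\in\mathcal A^i$, and where, for $e\mid g$, $\kappa_{i,g}(e)$ is the number of residue classes modulo $g$ occupied by those $h\in\mathcal H_i$ with $h\equiv0\ (\mathrm{mod}\ e)$. Assume that $c_3\ne0$. Let $0<\alpha<1$ and let $(P_j)_{j\ge0}$ be an $\alpha$-random walk on $\mathbb N^2$: $P_0=(0,0)$, and the steps $P_{j+1}-P_j$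 are independent, each equal to $(1,0)$ with probability $\alpha$ and to $(0,1)$ with probability $1-\alpha$. Then the products defining $c_1,c_2$ and the series defining $c_3$ converge (unconditionally), and almost surely $$\lim_{n\to\infty}\frac{\#\{1\le j\le n: P_j\in\mathcal V^3\}}{n}=c_1c_2c_3 .$$ -/

import Mathlib

open Filter Topology MeasureTheory ProbabilityTheory

noncomputable section

namespace SievedWalk

/-- `nu H g`: the number of residue classes modulo `g` occupied by the elements of `H`. -/
def nu (H : Finset ℤ) (g : ℕ) : ℕ :=
  (H.image (fun h : ℤ => (h : ZMod g))).card

/-- `H` is admissible with respect to `G`: it does not fill up all classes modulo any `g ∈ G`. -/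
def Admissible (G : Set ℕ) (H : Finset ℤ) : Prop :=
  ∀ g ∈ G, nu H g < g

/-- The set of natural numbers sieved by `G` with respect to `H`. -/
def sieved (G : Set ℕ) (H : Finset ℤ) : Set ℕ :=
  {n | ∀ h ∈ H, ∀ g ∈ G, ¬ ((n : ℤ) ≡ h [ZMOD (g : ℤ)])}

/-- All products of finitely many distinct elements of `G`; the empty product is `1`. -/
def distinctProducts (G : Set ℕ) : Set ℕ :=
  {a | ∃ s : Finset ℕ, (s : Set ℕ) ⊆ G ∧ a = ∏ g ∈ s, g}

/-- The truncation of `distinctProducts G` to the numbers that are at most `x ^ A`. -/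
def truncProducts (G : Set ℕ) (A : ℝ) (x : ℝ) : Set ℕ :=
  {a | a ∈ distinctProducts G ∧ (a : ℝ) ≤ x ^ A}

/-- Condition A with exponent `θ` (and constants `A`, `ε`) for a family `S x` of sets of integers:
`a ≪ x ^ A` for `a ∈ S x`, and `|S x ∩ [1, y]| ≪ y ^ θ / (log y) ^ A` for `y ≥ x ^ ε`, with implied
constants that do not depend on `x`, `a`, `y`, for all sufficiently large `x`. -/
def ConditionA (θ A ε : ℝ) (S : ℝ → Set ℕ) : Prop :=
  (∃ C : ℝ, ∀ᶠ x : ℝ in atTop, ∀ a ∈ S x, (a : ℝ) ≤ C * x ^ A) ∧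
  (∃ C : ℝ, ∀ᶠ x : ℝ in atTop, ∀ y : ℝ, x ^ ε ≤ y →
    (({a | a ∈ S x ∧ 1 ≤ a ∧ (a : ℝ) ≤ y} : Set ℕ).ncard : ℝ) ≤ C * (y ^ θ / Real.log y ^ A))

/-- The density `∏_{g ∈ G} (1 - ν_g(H) / g)` of `sieved G H`. -/
def sieveConst (G : Set ℕ) (H : Finset ℤ) : ℝ :=
  ∏' g : G, (1 - (nu H g : ℝ) / ((g : ℕ) : ℝ))

/-- The elements of `G` that are not coprime to `r`. -/
def nonCoprimeTo (G : Set ℕ) (r : ℕ) : Set ℕ :=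
  {g | g ∈ G ∧ 1 < Nat.gcd g r}

/-- `kappa H g d`: the number of residue classes modulo `g` occupied by those elements of `H`
that are divisible by `d` (below, `d` is a divisor of `g`). -/
def kappa (H : Finset ℤ) (g d : ℕ) : ℕ :=
  ((H.filter (fun h : ℤ => (d : ℤ) ∣ h)).image (fun h : ℤ => (h : ZMod g))).card

/-- `ω(d)`: the product of `-κ_g((g, d)) / g` over the finitely many `g ∈ G` with `(g, d) > 1`. -/
def omegaFactor (G : Set ℕ) (H : Finset ℤ) (d : ℕ) : ℝ :=
  ∏ᶠ g ∈ nonCoprimeTo G d, (-(kappa H g (Nat.gcd g d) : ℝ) / (g : ℝ))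

open Classical in
/-- The divisors `d` of `(r, ∏_{h ∈ H} h)` of the form `d = (r, a)` with `a` a product of distinct
elements of `G`. -/
def sieveDivisors (G : Set ℕ) (H : Finset ℤ) (r : ℕ) : Finset ℕ :=
  r.divisors.filter
    (fun d => (d : ℤ) ∣ ∏ h ∈ H, h ∧ ∃ a ∈ distinctProducts G, d = Nat.gcd r a)

/-- The arithmetic factor `f(r)`. -/
def fFactor (G : Set ℕ) (H : Finset ℤ) (r : ℕ) : ℝ :=
  (∏ᶠ g ∈ nonCoprimeTo G r, (1 - (nu H g : ℝ) / (g : ℝ))⁻¹) *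
    ∑ d ∈ sieveDivisors G H r, (d : ℝ) * omegaFactor G H d

/-- The `r`-th term of the series for `c₃`; it is `0` for `r = 0`, because `μ 0 = 0`. -/
def visTerm (G₁ G₂ : Set ℕ) (H₁ H₂ : Finset ℤ) (r : ℕ) : ℝ :=
  (ArithmeticFunction.moebius r : ℝ) / (r : ℝ) ^ 2 * fFactor G₁ H₁ r * fFactor G₂ H₂ r

/-- The constant `c₃`. -/
def visConst (G₁ G₂ : Set ℕ) (H₁ H₂ : Finset ℤ) : ℝ :=
  ∑' r : ℕ, visTerm G₁ G₂ H₁ H₂ r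

/-- The visible lattice points with first coordinate in `sieved G₁ H₁` and second coordinate in
`sieved G₂ H₂`. -/
def sievedVisible (G₁ G₂ : Set ℕ) (H₁ H₂ : Finset ℤ) : Set (ℕ × ℕ) :=
  {p | p.1 ∈ sieved G₁ H₁ ∧ p.2 ∈ sieved G₂ H₂ ∧ Nat.Coprime p.1 p.2}

/-- `P` is an `α`-random walk on `ℕ²`: it starts at `(0, 0)`, and its steps are independent, each
equal to `(1, 0)` with probability `α` and to `(0, 1)` with probability `1 - α`. -/
def IsAlphaWalk {Ω : Type*} [MeasurableSpace Ω] (α : ℝ) (P : ℕ → Ω → ℕ × ℕ) (μ : Measure Ω) :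
    Prop :=
  ∃ ξ : ℕ → Ω → ℕ × ℕ,
    (∀ i, Measurable (ξ i)) ∧ iIndepFun ξ μ ∧
    (∀ i, μ {ω | ξ i ω = (1, 0)} = ENNReal.ofReal α) ∧
    (∀ i, μ {ω | ξ i ω = (0, 1)} = ENNReal.ofReal (1 - α)) ∧
    (∀ ω, P 0 ω = (0, 0)) ∧ (∀ i ω, P (i + 1) ω = P i ω + ξ i ω)

/-- The proportion of the steps `1, …, n` at which the walk `P` is in `V`. -/
def visitProportion {Ω : Type*} (V : Set (ℕ × ℕ)) (P : ℕ → Ω → ℕ × ℕ) (n : ℕ) (ω : Ω) : ℝ :=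
  (∑ i ∈ Finset.Icc 1 n, V.indicator (fun _ => (1 : ℝ)) (P i ω)) / (n : ℝ)

end SievedWalk

end

/-! Let `X_j` be the first coordinate of the walk at time `j`; the second is `j - X_j`. Membership
in the visible sieved set is an infinite system of congruence conditions. Keeping only the moduli
and the primes below `Q` leaves a periodic function of the two coordinates, whose mean is computed
by the Chinese remainder theorem and Möbius inversion (`mean_siftInd`, `truncInd_eq`). As `Q` grows,
these means tend to `c₁c₂c₃` by dominated convergence, because `c_i f_i(r)` is a limit of densities
and so lies in `[0, 1]` (`tendsto_sum_partialDensity`).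

Time averages along the walk are controlled by two facts. The binomial law after `n` steps is
equidistributed modulo `q` with error `O(n^(-1/2))`, uniformly in `q` and in the starting point;
this follows from Stein's identity (`abs_iter_classInd_sub_le`). And on average the value of a
bounded function at time `j` may be replaced by its conditional expectation given the walk at time
`j - √j`: the differences are orthogonal unless their times are within about `√j`, so a second
moment bound suffices (`IsBernoulliSeq.ae_tendsto_avg_sub_iter`). Together they give the almost sure
averages of periodic functions.

The discarded conditions are rarely violated. Each level is left exactly once, so the walk spends at
most `1/α` times the density of a set of levels in that set (`IsBernoulliSeq.ae_avg_le`); for large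
`g` this is a tail of `∑ 1/g`, which converges by Condition A. A large prime dividing both
coordinates divides `j` and `X_j`. There are `O(log j)` primes dividing `j`, each with conditional
probability `1/p + O(j^(-1/4))`, and the average over `j` is at most a tail of `∑ 1/k²` plus `o(1)`
(`IsBernoulliSeq.ae_avg_commonInd_le`). Letting `n → ∞` and then `Q → ∞` gives the limit. -/

namespace SievedWalk

/-! ### Stein's identity and equidistribution of the binomial law -/

/-- The transition operator of the random walk on `ℕ` with step `1` with probability `α` and step
`0` with probability `1 - α`. -/
def stepOp (α : ℝ) (φ : ℕ → ℝ) (x : ℕ) : ℝ := α * φ (x + 1) + (1 - α) * φ x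

/-- Multiplication of a function by `y - s`. -/
def centredMul (s : ℝ) (φ : ℕ → ℝ) (y : ℕ) : ℝ := ((y : ℝ) - s) * φ y

/-- The forward difference of a function on `ℕ`. -/
def fwd (φ : ℕ → ℝ) (x : ℕ) : ℝ := φ (x + 1) - φ x

/-- Multiplication by `y - s` commutes with a step up to a shift of the centre and a difference
term; iterating this yields Stein's identity. -/
lemma stepOp_centredMul (α s : ℝ) (φ : ℕ → ℝ) :
    stepOp α (centredMul s φ)
      = centredMul (s - α) (stepOp α φ) + (α * (1 - α)) • fwd φ := by
  ext x
  simp only [stepOp, centredMul, fwd, Pi.add_apply, Pi.smul_apply, smul_eq_mul]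
  push_cast
  ring

lemma stepOp_add (α : ℝ) (φ ψ : ℕ → ℝ) : stepOp α (φ + ψ) = stepOp α φ + stepOp α ψ := by
  ext x; simp only [stepOp, Pi.add_apply]; ring

lemma stepOp_smul (α c : ℝ) (φ : ℕ → ℝ) : stepOp α (c • φ) = c • stepOp α φ := by
  ext x; simp only [stepOp, Pi.smul_apply, smul_eq_mul]; ring

lemma stepOp_const (α c : ℝ) : stepOp α (fun _ => c) = fun _ => c := by
  ext x; simp only [stepOp]; ring

lemma stepOp_fwd (α : ℝ) (φ : ℕ → ℝ) : stepOp α (fwd φ) = fwd (stepOp α φ) := by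
  ext x; simp only [stepOp, fwd]; ring

lemma stepOp_mono {α : ℝ} (h0 : 0 ≤ α) (h1 : α ≤ 1) : Monotone (stepOp α) := by
  intro φ ψ h x
  have h2 := mul_le_mul_of_nonneg_left (h (x + 1)) h0
  have h3 := mul_le_mul_of_nonneg_left (h x) (sub_nonneg.2 h1)
  simp only [stepOp]
  linarith

lemma iter_add (α : ℝ) (n : ℕ) (φ ψ : ℕ → ℝ) :
    (stepOp α)^[n] (φ + ψ) = (stepOp α)^[n] φ + (stepOp α)^[n] ψ := by
  induction n generalizing φ ψ with
  | zero => rfl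
  | succ n ih => simp only [Function.iterate_succ_apply, stepOp_add, ih]

lemma iter_smul (α c : ℝ) (n : ℕ) (φ : ℕ → ℝ) :
    (stepOp α)^[n] (c • φ) = c • (stepOp α)^[n] φ := by
  induction n generalizing φ with
  | zero => rfl
  | succ n ih => simp only [Function.iterate_succ_apply, stepOp_smul, ih]

lemma iter_const (α c : ℝ) (n : ℕ) : (stepOp α)^[n] (fun _ => c) = fun _ => c :=
  Function.iterate_fixed (stepOp_const α c) n

lemma iter_fwd (α : ℝ) (n : ℕ) (φ : ℕ → ℝ) :
    (stepOp α)^[n] (fwd φ) = fwd ((stepOp α)^[n] φ) := by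
  induction n generalizing φ with
  | zero => rfl
  | succ n ih => simp only [Function.iterate_succ_apply, stepOp_fwd, ih]

lemma iter_mono {α : ℝ} (h0 : 0 ≤ α) (h1 : α ≤ 1) (n : ℕ) : Monotone ((stepOp α)^[n]) :=
  (stepOp_mono h0 h1).iterate n

/-- The Stein identity for the binomial distribution. -/
lemma iter_centredMul (α s : ℝ) (n : ℕ) (φ : ℕ → ℝ) :
    (stepOp α)^[n + 1] (centredMul s φ) = centredMul (s - (n + 1) * α) ((stepOp α)^[n + 1] φ)
      + ((n + 1) * (α * (1 - α))) • fwd ((stepOp α)^[n] φ) := by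
  induction n generalizing s φ with
  | zero => simp [stepOp_centredMul]
  | succ n ih =>
    rw [Function.iterate_succ_apply, stepOp_centredMul, iter_add, iter_smul, ih, iter_fwd,
      ← Function.iterate_succ_apply, ← Function.iterate_succ_apply]
    ext x
    simp only [Pi.add_apply, Pi.smul_apply, smul_eq_mul, centredMul, Nat.cast_add, Nat.cast_one]
    ring

lemma iter_centredMul_one (α s : ℝ) (n : ℕ) :
    (stepOp α)^[n] (centredMul s fun _ => 1) = centredMul (s - n * α) fun _ => 1 := by
  cases n with
  | zero => simp
  | succ n =>
    rw [iter_centredMul, iter_const, iter_const]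
    ext x
    simp [fwd, centredMul]

/-- The variance of the binomial distribution. -/
lemma iter_variance (α : ℝ) (n x : ℕ) :
    (stepOp α)^[n + 1] (fun y => ((y : ℝ) - (x + (n + 1) * α)) ^ 2) x
      = (n + 1) * (α * (1 - α)) := by
  have h : (fun y : ℕ => ((y : ℝ) - (x + (n + 1) * α)) ^ 2)
      = centredMul (x + (n + 1) * α) (centredMul (x + (n + 1) * α) fun _ => 1) := by
    ext y; simp only [centredMul]; ring
  rw [h, iter_centredMul, iter_centredMul_one, iter_centredMul_one]
  simp [centredMul, fwd]

/-- Centring Stein's identity at the mean `x + (n + 1)α` kills its first term, so `V` times the left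
side is an expectation of `(y - s) φ y`, hence at most the mean absolute deviation, hence at most
`√V`. -/
lemma abs_iter_fwd_le {α : ℝ} (h0 : 0 < α) (h1 : α < 1) (n x : ℕ) {φ : ℕ → ℝ}
    (hφ : ∀ y, |φ y| ≤ 1) :
    |(stepOp α)^[n] (fwd φ) x| ≤ 1 / √((n + 1) * (α * (1 - α))) := by
  set V : ℝ := (n + 1) * (α * (1 - α)) with hV
  have hVpos : 0 < V := by
    have := sub_pos.2 h1
    positivity
  have hsV : 0 < √V := Real.sqrt_pos.2 hVpos
  have key : ∀ φ : ℕ → ℝ, (∀ y, |φ y| ≤ 1) → V * (stepOp α)^[n] (fwd φ) x ≤ √V := by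
    intro φ hφ
    set s : ℝ := x + (n + 1) * α with hs
    have e := congrFun (iter_centredMul α s n φ) x
    have hz : (x : ℝ) - (s - (n + 1) * α) = 0 := by rw [hs]; ring
    rw [Pi.add_apply, centredMul, hz, zero_mul, zero_add, Pi.smul_apply, smul_eq_mul,
      ← iter_fwd, ← hV] at e
    rw [← e]
    -- The inequality `2ab ≤ a² + b²` with weight `√V` replaces Cauchy–Schwarz, so that only
    -- linearity and monotonicity of the iterates are needed.
    have hle : centredMul s φ ≤ ((1 / (2 * √V)) • (fun y : ℕ => ((y : ℝ) - s) ^ 2))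
        + fun _ => √V / 2 := by
      intro y
      simp only [centredMul, Pi.add_apply, Pi.smul_apply, smul_eq_mul]
      have h2 : ((y : ℝ) - s) * φ y ≤ |(y : ℝ) - s| := by
        refine (le_abs_self _).trans ?_
        rw [abs_mul]
        exact mul_le_of_le_one_right (abs_nonneg _) (hφ y)
      refine h2.trans ?_
      rw [← sq_abs, div_mul_eq_mul_div, one_mul, div_add_div _ _ (by positivity) (by norm_num),
        le_div_iff₀ (by positivity)]
      nlinarith [sq_nonneg (|(y : ℝ) - s| - √V)]
    refine (iter_mono h0.le h1.le (n + 1) hle x).trans ?_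
    rw [iter_add, iter_smul, iter_const, Pi.add_apply, Pi.smul_apply, iter_variance, ← hV,
      smul_eq_mul]
    have : 1 / (2 * √V) * V = √V / 2 := by
      field_simp
      rw [Real.sq_sqrt hVpos.le]
    rw [this]
    linarith
  have e1 : V * (1 / √V) = √V := by
    field_simp
    rw [Real.sq_sqrt hVpos.le]
  rw [abs_le]
  constructor
  · have h2 := key ((-1 : ℝ) • φ) (by intro y; simpa using hφ y)
    have h3 : fwd ((-1 : ℝ) • φ) = (-1 : ℝ) • fwd φ := by
      ext y; simp only [fwd, Pi.smul_apply, smul_eq_mul]; ring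
    rw [h3, iter_smul, Pi.smul_apply, smul_eq_mul] at h2
    refine le_of_mul_le_mul_left ?_ hVpos
    linarith
  · exact le_of_mul_le_mul_left ((key φ hφ).trans_eq e1.symm) hVpos

/-- The indicator function of the residue class `-u` modulo `q`. -/
def classInd (q u y : ℕ) : ℝ := if q ∣ y + u then 1 else 0

lemma classInd_nonneg (q u y : ℕ) : 0 ≤ classInd q u y := by
  unfold classInd; split_ifs <;> norm_num

lemma classInd_le_one (q u y : ℕ) : classInd q u y ≤ 1 := by
  unfold classInd; split_ifs <;> norm_num

/-- A sawtooth rises by `1/q` at each step except for one drop per period; the shift by `q - 1` puts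
the drop exactly where `q ∣ y + u`. Thus the centred class indicator is a difference of a function
bounded by `1`, whatever `q` is. -/
lemma fwd_mod {q : ℕ} (hq : 0 < q) (u y : ℕ) :
    fwd (fun y => (((y + u + (q - 1)) % q : ℕ) : ℝ) / q) y = 1 / q - classInd q u y := by
  have hq' : (q : ℝ) ≠ 0 := by positivity
  have e : y + 1 + u + (q - 1) = y + u + q := by omega
  simp only [fwd, e, Nat.add_mod_right, classInd]
  split_ifs with h
  · have h2 : (y + u + (q - 1)) % q = q - 1 := by
      obtain ⟨k, hk⟩ := h
      rw [hk, Nat.mul_add_mod]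
      exact Nat.mod_eq_of_lt (by omega)
    rw [h2, Nat.mod_eq_zero_of_dvd h, Nat.cast_sub hq]
    field_simp
    simp
  · have h2 : (y + u + (q - 1)) % q = (y + u) % q - 1 := by
      have h3 : 0 < (y + u) % q := Nat.pos_of_ne_zero fun h0 => h (Nat.dvd_of_mod_eq_zero h0)
      have h4 := Nat.mod_lt (y + u) hq
      have h5 : y + u + (q - 1) = q * ((y + u) / q + 1) + ((y + u) % q - 1) := by
        have := Nat.div_add_mod (y + u) q
        rw [mul_add]
        omega
      rw [h5, Nat.mul_add_mod]
      exact Nat.mod_eq_of_lt (by omega)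
    have h3 : 1 ≤ (y + u) % q := Nat.pos_of_ne_zero fun h0 => h (Nat.dvd_of_mod_eq_zero h0)
    rw [h2, Nat.cast_sub h3]
    field_simp
    simp

/-- The binomial distribution is equidistributed modulo `q`, uniformly in `q`. -/
lemma abs_iter_classInd_sub_le {α : ℝ} (h0 : 0 < α) (h1 : α < 1) {q : ℕ} (hq : 0 < q)
    (u n x : ℕ) :
    |(stepOp α)^[n] (classInd q u) x - 1 / q| ≤ 1 / √((n + 1) * (α * (1 - α))) := by
  have h := abs_iter_fwd_le h0 h1 n x (φ := fun y => (((y + u + (q - 1)) % q : ℕ) : ℝ) / q)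
    (by
      intro y
      rw [abs_of_nonneg (by positivity)]
      rw [div_le_one (by positivity)]
      exact_mod_cast (Nat.mod_lt _ hq).le)
  have e : fwd (fun y => (((y + u + (q - 1)) % q : ℕ) : ℝ) / q)
      = (fun _ => 1 / (q : ℝ)) + (-1 : ℝ) • classInd q u := by
    ext y
    rw [fwd_mod hq, Pi.add_apply, Pi.smul_apply, smul_eq_mul]
    ring
  rw [e, iter_add, iter_smul, iter_const, Pi.add_apply, Pi.smul_apply, smul_eq_mul] at h
  rw [abs_sub_comm]
  convert h using 2
  ring

/-! ### A strong law for variables orthogonal beyond a lag `√j` -/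

section LawOfLargeNumbers

variable {Ω : Type*} [MeasurableSpace Ω] {μ : Measure Ω} [IsProbabilityMeasure μ]

lemma integrable_of_abs_le {f : Ω → ℝ} (hm : Measurable f) {C : ℝ} (hb : ∀ ω, |f ω| ≤ C) :
    Integrable f μ :=
  Integrable.of_bound hm.aestronglyMeasurable C (ae_of_all _ hb)

/-- In the expanded square only pairs with `|i - j| ≤ √n` contribute, and each contributes at most
`1`. -/
lemma integral_sq_sum_le {D : ℕ → Ω → ℝ} (hm : ∀ j, Measurable (D j)) (hb : ∀ j ω, |D j ω| ≤ 1)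
    (ho : ∀ i j, i + Nat.sqrt j + 1 ≤ j → ∫ ω, D i ω * D j ω ∂μ = 0) (n : ℕ) :
    ∫ ω, (∑ j ∈ Finset.range n, D j ω) ^ 2 ∂μ ≤ n * (2 * Nat.sqrt n + 1) := by
  have hb2 : ∀ i j ω, |D i ω * D j ω| ≤ 1 := fun i j ω => by
    rw [abs_mul]
    exact mul_le_one₀ (hb i ω) (abs_nonneg _) (hb j ω)
  have hint : ∀ i j, Integrable (fun ω => D i ω * D j ω) μ := fun i j =>
    integrable_of_abs_le ((hm i).mul (hm j)) (hb2 i j)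
  have e : ∫ ω, (∑ j ∈ Finset.range n, D j ω) ^ 2 ∂μ
      = ∑ i ∈ Finset.range n, ∑ j ∈ Finset.range n, ∫ ω, D i ω * D j ω ∂μ := by
    simp_rw [sq, Finset.sum_mul_sum]
    rw [integral_finsetSum _ fun i _ => integrable_finsetSum _ fun j _ => hint i j]
    exact Finset.sum_congr rfl fun i _ => integral_finsetSum _ fun j _ => hint i j
  rw [e]
  have hrow : ∀ i ∈ Finset.range n, ∑ j ∈ Finset.range n, ∫ ω, D i ω * D j ω ∂μ
      ≤ 2 * Nat.sqrt n + 1 := by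
    intro i hi
    have hle : ∀ j ∈ Finset.range n, ∫ ω, D i ω * D j ω ∂μ
        ≤ if j ∈ Finset.Icc (i - Nat.sqrt n) (i + Nat.sqrt n) then (1 : ℝ) else 0 := by
      intro j hj
      rw [Finset.mem_range] at hi hj
      split_ifs with h
      · refine (integral_mono (hint i j) (integrable_const 1)
          fun ω => (le_abs_self _).trans (hb2 i j ω)).trans ?_
        simp
      · have s1 := Nat.sqrt_le_sqrt hi.le
        have s2 := Nat.sqrt_le_sqrt hj.le
        rw [Finset.mem_Icc] at h
        by_cases hij : i ≤ j
        · exact (ho i j (by omega)).le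
        · have := ho j i (by omega)
          simp_rw [mul_comm (D i _)]
          exact this.le
    refine (Finset.sum_le_sum hle).trans ?_
    rw [← Finset.sum_filter, Finset.sum_const, nsmul_eq_mul, mul_one]
    have hc : (Finset.filter (· ∈ Finset.Icc (i - Nat.sqrt n) (i + Nat.sqrt n))
        (Finset.range n)).card ≤ 2 * Nat.sqrt n + 1 := by
      refine (Finset.card_le_card (t := Finset.Icc (i - Nat.sqrt n) (i + Nat.sqrt n)) ?_).trans ?_
      · intro j hj
        exact (Finset.mem_filter.1 hj).2
      · rw [Nat.card_Icc]
        omega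
    exact_mod_cast hc
  refine (Finset.sum_le_sum hrow).trans ?_
  rw [Finset.sum_const, Finset.card_range, nsmul_eq_mul]

/-- The mean square of the average over `n` terms is `O(n^(-1/2))`, which is summable along `n = k ^
4`. -/
lemma ae_summable_sq_avg {D : ℕ → Ω → ℝ} (hm : ∀ j, Measurable (D j))
    (hb : ∀ j ω, |D j ω| ≤ 1)
    (ho : ∀ i j, i + Nat.sqrt j + 1 ≤ j → ∫ ω, D i ω * D j ω ∂μ = 0) :
    ∀ᵐ ω ∂μ, Summable fun k : ℕ =>
      ‖((∑ j ∈ Finset.range (k ^ 4), D j ω) / (k : ℝ) ^ 4) ^ 2‖ := by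
  have hmf : ∀ k : ℕ, Measurable fun ω =>
      ((∑ j ∈ Finset.range (k ^ 4), D j ω) / (k : ℝ) ^ 4) ^ 2 := fun k =>
    ((Finset.measurable_sum _ fun j _ => hm j).div_const _).pow_const 2
  have hsb : ∀ (k : ℕ) ω, |∑ j ∈ Finset.range k, D j ω| ≤ k := fun k ω => by
    refine (Finset.abs_sum_le_sum_abs _ _).trans ?_
    refine (Finset.sum_le_sum fun j _ => hb j ω).trans ?_
    simp
  have hint : ∀ k : ℕ, Integrable (fun ω =>
      ((∑ j ∈ Finset.range (k ^ 4), D j ω) / (k : ℝ) ^ 4) ^ 2) μ := fun k => by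
    refine integrable_of_abs_le (hmf k) (C := 1) fun ω => ?_
    rw [abs_pow, abs_div, abs_of_nonneg (by positivity : (0 : ℝ) ≤ (k : ℝ) ^ 4)]
    refine pow_le_one₀ (by positivity) (div_le_one_of_le₀ ?_ (by positivity))
    exact_mod_cast hsb (k ^ 4) ω
  refine summable_norm_of_tsum_eLpNorm_ne_top (p := 1) le_rfl
    (fun k => (hmf k).aestronglyMeasurable) ?_
  have hle : ∀ k : ℕ, eLpNorm (fun ω =>
      ((∑ j ∈ Finset.range (k ^ 4), D j ω) / (k : ℝ) ^ 4) ^ 2) 1 μ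
      ≤ ENNReal.ofReal (3 * (1 / (k : ℝ) ^ 2)) := by
    intro k
    rw [eLpNorm_one_eq_lintegral_enorm, ← ofReal_integral_norm_eq_lintegral_enorm (hint k)]
    refine ENNReal.ofReal_le_ofReal ?_
    rcases Nat.eq_zero_or_pos k with rfl | hk
    · simp
    have hs : Nat.sqrt (k ^ 4) = k ^ 2 := by
      rw [show k ^ 4 = (k ^ 2) ^ 2 by ring, Nat.sqrt_eq']
    have h1 := integral_sq_sum_le hm hb ho (k ^ 4)
    simp_rw [Real.norm_eq_abs, abs_pow, sq_abs, div_pow]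
    rw [integral_div, div_le_iff₀ (by positivity)]
    refine h1.trans ?_
    rw [hs]
    push_cast
    have hk1 : (1 : ℝ) ≤ (k : ℝ) ^ 2 := one_le_pow₀ (by exact_mod_cast hk)
    have e : 3 * (1 / (k : ℝ) ^ 2) * ((k : ℝ) ^ 4) ^ 2 = (k : ℝ) ^ 4 * (3 * (k : ℝ) ^ 2) := by
      field_simp
    rw [e]
    gcongr
    linarith
  refine ne_top_of_le_ne_top ?_ (ENNReal.tsum_le_tsum hle)
  have hsum : Summable fun k : ℕ => 3 * (1 / (k : ℝ) ^ 2) :=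
    (Real.summable_one_div_nat_pow.2 (by norm_num)).mul_left 3
  rw [← ENNReal.ofReal_tsum_of_nonneg (fun k => by positivity) hsum]
  exact ENNReal.ofReal_ne_top

/-- Consecutive fourth powers differ by `O(k ^ 3)`, negligible against `k ^ 4`, so bounded terms
cannot move the average in between. -/
lemma tendsto_avg_of_pow_four {d : ℕ → ℝ} (hb : ∀ j, |d j| ≤ 1)
    (h : Tendsto (fun k : ℕ => (∑ j ∈ Finset.range (k ^ 4), d j) / (k : ℝ) ^ 4) atTop (𝓝 0)) :
    Tendsto (fun n : ℕ => (∑ j ∈ Finset.range n, d j) / (n : ℝ)) atTop (𝓝 0) := by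
  have hr : Tendsto (fun n : ℕ => Nat.sqrt (Nat.sqrt n)) atTop atTop := by
    have h1 : Tendsto Nat.sqrt atTop atTop :=
      tendsto_atTop.2 fun b => eventually_atTop.2 ⟨b ^ 2, fun n hn => Nat.le_sqrt'.2 hn⟩
    exact h1.comp h1
  have h2 : Tendsto (fun k : ℕ => |(∑ j ∈ Finset.range (k ^ 4), d j) / (k : ℝ) ^ 4|
      + 15 / (k : ℝ)) atTop (𝓝 0) := by
    simpa using h.abs.add (tendsto_const_div_atTop_nhds_zero_nat 15)
  refine squeeze_zero_norm' ?_ (h2.comp hr)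
  filter_upwards [eventually_ge_atTop 1] with n hn
  set k := Nat.sqrt (Nat.sqrt n) with hk
  have hk1 : 1 ≤ k := Nat.le_sqrt'.2 (Nat.le_sqrt'.2 (by simpa using hn))
  have hkn : k ^ 4 ≤ n := by
    have h3 : k ^ 2 ≤ Nat.sqrt n := Nat.sqrt_le' _
    calc k ^ 4 = (k ^ 2) ^ 2 := by ring
      _ ≤ (Nat.sqrt n) ^ 2 := Nat.pow_le_pow_left h3 2
      _ ≤ n := Nat.sqrt_le' _
  have hnk : n < (k + 1) ^ 4 := by
    have h3 : Nat.sqrt n < (k + 1) ^ 2 := Nat.lt_succ_sqrt' _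
    calc n < (Nat.sqrt n + 1) ^ 2 := Nat.lt_succ_sqrt' _
      _ ≤ ((k + 1) ^ 2) ^ 2 := Nat.pow_le_pow_left h3 2
      _ = (k + 1) ^ 4 := by ring
  have hkR : (1 : ℝ) ≤ k := by exact_mod_cast hk1
  have hknR : (k : ℝ) ^ 4 ≤ n := by exact_mod_cast hkn
  have hnkR : (n : ℝ) < ((k : ℝ) + 1) ^ 4 := by exact_mod_cast hnk
  have hsplit := Finset.sum_range_add_sum_Ico d hkn
  have hico : |∑ j ∈ Finset.Ico (k ^ 4) n, d j| ≤ (n : ℝ) - (k : ℝ) ^ 4 := by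
    refine (Finset.abs_sum_le_sum_abs _ _).trans ((Finset.sum_le_sum fun j _ => hb j).trans ?_)
    simp [Nat.cast_sub hkn]
  -- `(k + 1) ^ 4 - k ^ 4 = 4k³ + 6k² + 4k + 1 ≤ 15k³` for `k ≥ 1`.
  have hgap : (n : ℝ) - (k : ℝ) ^ 4 ≤ 15 * (k : ℝ) ^ 3 := by
    have a1 : (k : ℝ) ^ 2 ≤ (k : ℝ) ^ 3 := pow_le_pow_right₀ hkR (by norm_num)
    have a2 : (k : ℝ) ≤ (k : ℝ) ^ 3 := le_self_pow₀ hkR (by norm_num)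
    have a3 : (1 : ℝ) ≤ (k : ℝ) ^ 3 := one_le_pow₀ hkR
    nlinarith
  have hnpos : (0 : ℝ) < n := by exact_mod_cast hn
  rw [Real.norm_eq_abs, ← hsplit, add_div, Function.comp_apply]
  refine (abs_add_le _ _).trans (add_le_add ?_ ?_)
  · rw [abs_div, abs_div, abs_of_nonneg hnpos.le,
      abs_of_nonneg (by positivity : (0 : ℝ) ≤ (k : ℝ) ^ 4)]
    gcongr
  · rw [abs_div, abs_of_nonneg hnpos.le]
    calc |∑ j ∈ Finset.Ico (k ^ 4) n, d j| / n ≤ 15 * (k : ℝ) ^ 3 / (k : ℝ) ^ 4 := by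
          gcongr
          exact hico.trans hgap
      _ = 15 / k := by field_simp

/-- A strong law of large numbers for bounded random variables that are orthogonal up to a slowly
growing lag. -/
theorem ae_tendsto_avg_zero {D : ℕ → Ω → ℝ} (hm : ∀ j, Measurable (D j))
    (hb : ∀ j ω, |D j ω| ≤ 1)
    (ho : ∀ i j, i + Nat.sqrt j + 1 ≤ j → ∫ ω, D i ω * D j ω ∂μ = 0) :
    ∀ᵐ ω ∂μ, Tendsto (fun n : ℕ => (∑ j ∈ Finset.range n, D j ω) / (n : ℝ)) atTop (𝓝 0) := by
  filter_upwards [ae_summable_sq_avg hm hb ho] with ω hω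
  refine tendsto_avg_of_pow_four (fun j => hb j ω) ?_
  have h1 := hω.tendsto_atTop_zero
  have h2 := (Real.continuous_sqrt.tendsto 0).comp h1
  rw [Real.sqrt_zero] at h2
  refine tendsto_zero_iff_abs_tendsto_zero _ |>.2 (h2.congr fun k => ?_)
  simp only [Function.comp_apply, Real.norm_eq_abs, abs_pow]
  exact Real.sqrt_sq (abs_nonneg _)

end LawOfLargeNumbers

/-! ### Markov property and orthogonality for the Bernoulli walk -/

section BernoulliWalk

variable {Ω : Type*} [MeasurableSpace Ω]

/-- `η` is a sequence of independent random variables that are `1` with probability `α` and `0`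
with probability `1 - α`. -/
structure IsBernoulliSeq (α : ℝ) (η : ℕ → Ω → ℕ) (μ : Measure Ω) : Prop where
  meas : ∀ i, Measurable (η i)
  indep : iIndepFun η μ
  le_one : ∀ i ω, η i ω ≤ 1
  mean : ∀ i, ∫ ω, (η i ω : ℝ) ∂μ = α

/-- The sum of the variables with index in `[a, b)`. -/
def incr (η : ℕ → Ω → ℕ) (a b : ℕ) (ω : Ω) : ℕ := ∑ i ∈ Finset.Ico a b, η i ω

omit [MeasurableSpace Ω] in
lemma incr_add (η : ℕ → Ω → ℕ) {a b c : ℕ} (hab : a ≤ b) (hbc : b ≤ c) (ω : Ω) :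
    incr η a b ω + incr η b c ω = incr η a c ω :=
  Finset.sum_Ico_consecutive _ hab hbc

variable {μ : Measure Ω} [IsProbabilityMeasure μ] {α : ℝ} {η : ℕ → Ω → ℕ}

omit [IsProbabilityMeasure μ] in
lemma IsBernoulliSeq.measurable_incr (h : IsBernoulliSeq α η μ) (a b : ℕ) :
    Measurable (incr η a b) :=
  Finset.measurable_sum _ fun i _ => h.meas i

/-- The expectation over an increment of the walk is an iterate of the transition operator. -/
lemma IsBernoulliSeq.integral_incr (h : IsBernoulliSeq α η μ) (a n : ℕ) {ψ : ℕ → ℝ} {C : ℝ}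
    (hψ : ∀ y, |ψ y| ≤ C) (x : ℕ) :
    ∫ ω, ψ (x + incr η a (a + n) ω) ∂μ = (stepOp α)^[n] ψ x := by
  induction n generalizing x with
  | zero => simp [incr]
  | succ n ih =>
    have hind : IndepFun (incr η a (a + n)) (η (a + n)) μ := by
      have := h.indep.indepFun_finsetSum_of_notMem h.meas (s := Finset.Ico a (a + n))
        (i := a + n) (by simp)
      convert this using 1
      ext ω
      simp [incr]
    have hmη : Measurable fun ω => (η (a + n) ω : ℝ) := measurable_from_top.comp (h.meas _)
    have hmψ : ∀ c, Measurable fun ω => ψ (x + c + incr η a (a + n) ω) := fun c =>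
      (measurable_from_top (f := fun y => ψ (x + c + y))).comp (h.measurable_incr _ _)
    have hI : ∀ c, Integrable (fun ω => ψ (x + c + incr η a (a + n) ω)) μ := fun c =>
      integrable_of_abs_le (hmψ c) fun ω => hψ _
    have hprod : ∀ c, ∫ ω, ψ (x + c + incr η a (a + n) ω) * (η (a + n) ω : ℝ) ∂μ
        = (∫ ω, ψ (x + c + incr η a (a + n) ω) ∂μ) * α := fun c => by
      rw [← h.mean (a + n)]
      have hi2 : IndepFun (fun ω => ψ (x + c + incr η a (a + n) ω))
          (fun ω => (η (a + n) ω : ℝ)) μ :=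
        hind.comp (φ := fun y => ψ (x + c + y)) (ψ := fun y : ℕ => (y : ℝ))
          measurable_from_top measurable_from_top
      exact hi2.integral_fun_mul_eq_mul_integral (hmψ c).aestronglyMeasurable
        hmη.aestronglyMeasurable
    have hIη : ∀ c, Integrable (fun ω => ψ (x + c + incr η a (a + n) ω) * (η (a + n) ω : ℝ)) μ :=
      fun c => integrable_of_abs_le ((hmψ c).mul hmη) (C := C) fun ω => by
        rw [abs_mul]
        have h1 : |(η (a + n) ω : ℝ)| ≤ 1 := by
          rw [abs_of_nonneg (Nat.cast_nonneg _)]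
          exact_mod_cast h.le_one _ _
        exact (mul_le_of_le_one_right (abs_nonneg _) h1).trans (hψ _)
    -- As the last step is `0` or `1`, the value is affine in it, and independence turns the last
    -- step into the weights `α` and `1 - α` of the transition operator.
    have hpt : ∀ ω, ψ (x + incr η a (a + (n + 1)) ω)
        = ψ (x + 1 + incr η a (a + n) ω) * (η (a + n) ω : ℝ)
          + (ψ (x + 0 + incr η a (a + n) ω)
            - ψ (x + 0 + incr η a (a + n) ω) * (η (a + n) ω : ℝ)) := by
      intro ω
      have e : incr η a (a + (n + 1)) ω = incr η a (a + n) ω + η (a + n) ω := by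
        rw [incr, ← add_assoc, Finset.sum_Ico_succ_top (by omega)]
        rfl
      rw [e]
      have h1 := h.le_one (a + n) ω
      interval_cases hη : η (a + n) ω
      · simp
      · simp only [add_zero, Nat.cast_one, mul_one, sub_self]
        congr 1
        ring
    have hIs : Integrable (fun ω => ψ (x + 0 + incr η a (a + n) ω)
        - ψ (x + 0 + incr η a (a + n) ω) * (η (a + n) ω : ℝ)) μ := (hI 0).sub (hIη 0)
    rw [integral_congr_ae (ae_of_all _ hpt), integral_add (hIη 1) hIs,
      integral_sub (hI 0) (hIη 0), hprod, hprod, ih, ih, Function.iterate_succ_apply']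
    simp only [stepOp, add_zero]
    ring

/-- Random variables that depend on disjoint stretches of the walk are orthogonal when the later
one is centred given the past. -/
lemma IsBernoulliSeq.integral_mul_eq_zero (h : IsBernoulliSeq α η μ) {a b : ℕ}
    {F : (Finset.range a → ℕ) → ℝ} {Ψ : ℕ → ℕ → ℝ} {C : ℝ} (hF : ∀ u, |F u| ≤ 1)
    (hΨ : ∀ x y, |Ψ x y| ≤ C) (hc : ∀ x, ∫ ω, Ψ x (incr η a b ω) ∂μ = 0) :
    ∫ ω, F (fun i => η i ω) * Ψ (incr η 0 a ω) (incr η a b ω) ∂μ = 0 := by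
  have hind : IndepFun (fun ω (i : Finset.range a) => η i ω) (incr η a b) μ := by
    have h1 := h.indep.indepFun_finset (Finset.range a) (Finset.Ico a b) (by
      rw [Finset.disjoint_left]
      intro i hi hi'
      rw [Finset.mem_range] at hi
      rw [Finset.mem_Ico] at hi'
      omega) h.meas
    have h2 := h1.comp (φ := id) (ψ := fun v : Finset.Ico a b → ℕ => ∑ i, v i)
      measurable_id Measurable.of_discrete
    have h3 : incr η a b = (fun v : Finset.Ico a b → ℕ => ∑ i, v i) ∘ fun ω i => η i ω :=
      funext fun ω => (Finset.sum_coe_sort (Finset.Ico a b) fun i => η i ω).symm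
    rw [h3]
    exact h2
  have hmU : Measurable fun ω (i : Finset.range a) => η i ω :=
    measurable_pi_lambda _ fun i => h.meas i
  have hmS := h.measurable_incr a b
  set U : Ω → (Finset.range a → ℕ) := fun ω i => η i ω with hU
  have hprod := (indepFun_iff_map_prod_eq_prod_map_map hmU.aemeasurable hmS.aemeasurable).1 hind
  let G : (Finset.range a → ℕ) × ℕ → ℝ := fun p => F p.1 * Ψ (∑ i, p.1 i) p.2
  have e : ∀ ω, F (fun i => η i ω) * Ψ (incr η 0 a ω) (incr η a b ω) = G (U ω, incr η a b ω) := by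
    intro ω
    simp only [G, hU]
    congr 2
    rw [incr, ← Finset.range_eq_Ico]
    exact (Finset.sum_coe_sort (Finset.range a) fun i => η i ω).symm
  have hGm : Measurable G := Measurable.of_discrete
  have := Measure.isProbabilityMeasure_map (μ := μ) hmU.aemeasurable
  have := Measure.isProbabilityMeasure_map (μ := μ) hmS.aemeasurable
  have hGb : ∀ p, |G p| ≤ C := fun p => by
    simp only [G, abs_mul]
    exact (mul_le_of_le_one_left (abs_nonneg _) (hF _)).trans (hΨ _ _)
  simp_rw [e]
  -- By independence the joint law is a product; integrating over the later stretch first, with the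
  -- past fixed, gives `0` by `hc`.
  rw [← integral_map (φ := fun ω => (U ω, incr η a b ω)) (hmU.prodMk hmS).aemeasurable
    hGm.aestronglyMeasurable, hprod, integral_prod _ (integrable_of_abs_le hGm hGb)]
  refine integral_eq_zero_of_ae (ae_of_all _ fun u => ?_)
  simp only [G, integral_const_mul, Pi.zero_apply]
  rw [integral_map hmS.aemeasurable (Measurable.of_discrete).aestronglyMeasurable, hc, mul_zero]

/-- The law of large numbers for functionals of the walk that are centred given a slightly earlier
state. -/
theorem IsBernoulliSeq.ae_tendsto_avg_zero (h : IsBernoulliSeq α η μ) {a b : ℕ → ℕ}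
    (hab : ∀ j, a j ≤ b j) (hba : ∀ i j, i + Nat.sqrt j + 1 ≤ j → b i ≤ a j)
    {Ψ : ℕ → ℕ → ℕ → ℝ} (hΨ : ∀ j x y, |Ψ j x y| ≤ 1)
    (hc : ∀ j x, ∫ ω, Ψ j x (incr η (a j) (b j) ω) ∂μ = 0) :
    ∀ᵐ ω ∂μ, Tendsto (fun n : ℕ => (∑ j ∈ Finset.range n,
      Ψ j (incr η 0 (a j) ω) (incr η (a j) (b j) ω)) / (n : ℝ)) atTop (𝓝 0) := by
  refine SievedWalk.ae_tendsto_avg_zero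
    (D := fun j ω => Ψ j (incr η 0 (a j) ω) (incr η (a j) (b j) ω)) ?_ (fun j ω => hΨ _ _ _) ?_
  · intro j
    exact (Measurable.of_discrete (f := fun p : ℕ × ℕ => Ψ j p.1 p.2)).comp
      ((h.measurable_incr _ _).prodMk (h.measurable_incr _ _))
  · intro i j hij
    have hb := hba i j hij
    -- Extending a finite history by zeros makes the earlier functional a function of the first `a
    -- j` steps. The padding is never read, since `b i ≤ a j`.
    let ext : (Finset.range (a j) → ℕ) → ℕ → ℕ := fun u k =>
      if hk : k ∈ Finset.range (a j) then u ⟨k, hk⟩ else 0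
    have := h.integral_mul_eq_zero (a := a j) (b := b j)
      (F := fun u => Ψ i (∑ k ∈ Finset.Ico 0 (a i), ext u k)
        (∑ k ∈ Finset.Ico (a i) (b i), ext u k)) (Ψ := Ψ j) (fun u => hΨ _ _ _) (hΨ j) (hc j)
    rw [← this]
    congr 1
    ext ω
    have hext : ∀ k, k < b i → ext (fun i => η i ω) k = η k ω := fun k hk => by
      simp only [ext]
      rw [dif_pos (Finset.mem_range.2 (hk.trans_le hb))]
    congr 2
    · exact Finset.sum_congr rfl fun k hk =>
        (hext k ((Finset.mem_Ico.1 hk).2.trans_le (hab i))).symm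
    · exact Finset.sum_congr rfl fun k hk => (hext k (Finset.mem_Ico.1 hk).2).symm

end BernoulliWalk

/-! ### Averages along the walk: conditioning, exits, residue classes -/

section Visits

variable {Ω : Type*} [MeasurableSpace Ω] {μ : Measure Ω} [IsProbabilityMeasure μ]
  {α : ℝ} {η : ℕ → Ω → ℕ}

lemma iter_mem_Icc {α : ℝ} (h0 : 0 ≤ α) (h1 : α ≤ 1) {ψ : ℕ → ℝ} (hψ0 : ∀ y, 0 ≤ ψ y)
    (hψ1 : ∀ y, ψ y ≤ 1) (n x : ℕ) : 0 ≤ (stepOp α)^[n] ψ x ∧ (stepOp α)^[n] ψ x ≤ 1 := by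
  have a := iter_mono h0 h1 n (show (fun _ => (0 : ℝ)) ≤ ψ from hψ0) x
  have b := iter_mono h0 h1 n (show ψ ≤ fun _ => (1 : ℝ) from hψ1) x
  rw [iter_const] at a b
  exact ⟨a, b⟩

/-- Replacing each value by its conditional expectation a little earlier does not change the
averages along the walk. -/
theorem IsBernoulliSeq.ae_tendsto_avg_sub_iter (h : IsBernoulliSeq α η μ) (h0 : 0 ≤ α)
    (h1 : α ≤ 1) {ψ : ℕ → ℕ → ℝ} (hψ0 : ∀ j y, 0 ≤ ψ j y) (hψ1 : ∀ j y, ψ j y ≤ 1) :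
    ∀ᵐ ω ∂μ, Tendsto (fun n : ℕ => (∑ j ∈ Finset.range n, (ψ j (incr η 0 j ω)
      - (stepOp α)^[Nat.sqrt j] (ψ j) (incr η 0 (j - Nat.sqrt j) ω))) / (n : ℝ)) atTop (𝓝 0) := by
  -- The random block for time `j` is `[j - √j, j)`; blocks are disjoint as soon as `i + √j + 1 ≤
  -- j`.
  have hs : ∀ j, j - Nat.sqrt j + Nat.sqrt j = j := fun j => Nat.sub_add_cancel (Nat.sqrt_le_self j)
  have := h.ae_tendsto_avg_zero (a := fun j => j - Nat.sqrt j) (b := fun j => j)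
    (fun j => Nat.sub_le _ _) (fun i j hij => by omega)
    (Ψ := fun j x y => ψ j (x + y) - (stepOp α)^[Nat.sqrt j] (ψ j) x)
    (fun j x y => by
      have a := iter_mem_Icc h0 h1 (hψ0 j) (hψ1 j) (Nat.sqrt j) x
      rw [abs_le]
      constructor <;> linarith [hψ0 j (x + y), hψ1 j (x + y)])
    (fun j x => by
      have hb : ∀ y, |ψ j y| ≤ 1 := fun y => abs_le.2 ⟨by linarith [hψ0 j y], hψ1 j y⟩
      have hI := h.integral_incr (j - Nat.sqrt j) (Nat.sqrt j) hb x
      rw [hs] at hI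
      rw [integral_sub _ (integrable_const _), hI, integral_const]
      · simp
      · exact integrable_of_abs_le ((measurable_from_top (f := fun y => ψ j (x + y))).comp
          (h.measurable_incr _ _)) fun ω => hb _)
  filter_upwards [this] with ω hω
  refine hω.congr fun n => ?_
  congr 1
  refine Finset.sum_congr rfl fun j _ => ?_
  rw [incr_add η (Nat.zero_le _) (Nat.sub_le _ _)]

omit [IsProbabilityMeasure μ] in
-- The walk leaves each level `m` exactly once, at the step with `η j ω = 1`, so weighting by `η`
-- turns a sum over times into a sum over levels.
lemma sum_range_exits (h : IsBernoulliSeq α η μ) (f : ℕ → ℝ) (n : ℕ) (ω : Ω) :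
    ∑ j ∈ Finset.range n, f (incr η 0 j ω) * (η j ω : ℝ)
      = ∑ m ∈ Finset.range (incr η 0 n ω), f m := by
  induction n with
  | zero => simp [incr]
  | succ n ih =>
    have e : incr η 0 (n + 1) ω = incr η 0 n ω + η n ω := by
      rw [incr, Finset.sum_Ico_succ_top (Nat.zero_le _)]
      rfl
    rw [Finset.sum_range_succ, ih, e]
    have := h.le_one n ω
    interval_cases η n ω
    · simp
    · simp [Finset.sum_range_succ]

omit [IsProbabilityMeasure μ] in
lemma incr_zero_le (h : IsBernoulliSeq α η μ) (n : ℕ) (ω : Ω) : incr η 0 n ω ≤ n := by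
  refine (Finset.sum_le_sum fun i _ => h.le_one i ω).trans ?_
  simp

/-- The proportion of time that the walk spends in a set is at most `α⁻¹` times the density of
that set. -/
theorem IsBernoulliSeq.ae_avg_le (h : IsBernoulliSeq α η μ) (h0 : 0 < α) (h1 : α < 1)
    {f : ℕ → ℝ} (hf0 : ∀ m, 0 ≤ f m) (hf1 : ∀ m, f m ≤ 1) :
    ∀ᵐ ω ∂μ, ∃ u : ℕ → ℝ, Tendsto u atTop (𝓝 0) ∧ ∀ n : ℕ,
      (∑ j ∈ Finset.range n, f (incr η 0 j ω)) / (n : ℝ)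
        ≤ (∑ m ∈ Finset.range n, f m) / (n : ℝ) / α + u n := by
  have := h.ae_tendsto_avg_zero (a := fun j => j) (b := fun j => j + 1)
    (fun j => Nat.le_succ _) (fun i j hij => by omega)
    -- Given the past, the next step has mean `α`. The truncation `min y 1` does not change a single
    -- step; it only keeps the functional bounded for every argument.
    (Ψ := fun j x y => f x * (((min y 1 : ℕ) : ℝ) - α))
    (fun j x y => by
      rw [abs_mul, abs_of_nonneg (hf0 x)]
      refine mul_le_one₀ (hf1 x) (abs_nonneg _) ?_
      have h2 : ((min y 1 : ℕ) : ℝ) ≤ 1 := by exact_mod_cast min_le_right y 1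
      have h3 : (0 : ℝ) ≤ ((min y 1 : ℕ) : ℝ) := Nat.cast_nonneg _
      rw [abs_le]
      constructor <;> linarith)
    (fun j x => by
      have e : ∀ ω, ((min (incr η j (j + 1) ω) 1 : ℕ) : ℝ) = (η j ω : ℝ) := fun ω => by
        simp [incr, h.le_one]
      simp_rw [e]
      rw [integral_const_mul, integral_sub _ (integrable_const _), h.mean, integral_const]
      · simp
      · refine integrable_of_abs_le (measurable_from_top.comp (h.meas j)) (C := 1) fun ω => ?_
        rw [abs_of_nonneg (Nat.cast_nonneg _)]
        exact_mod_cast h.le_one j ω)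
  filter_upwards [this] with ω hω
  have e : ∀ j, ((min (incr η j (j + 1) ω) 1 : ℕ) : ℝ) = (η j ω : ℝ) := fun j => by
    simp [incr, h.le_one]
  simp_rw [e] at hω
  refine ⟨fun n => -((∑ j ∈ Finset.range n, f (incr η 0 j ω) * ((η j ω : ℝ) - α)) / (n : ℝ) / α),
    by simpa using (hω.div_const α).neg, fun n => ?_⟩
  simp_rw [mul_sub, Finset.sum_sub_distrib, sum_range_exits h, ← Finset.sum_mul]
  have hle : ∑ m ∈ Finset.range (incr η 0 n ω), f m ≤ ∑ m ∈ Finset.range n, f m :=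
    Finset.sum_le_sum_of_subset_of_nonneg (Finset.range_subset_range.2 (incr_zero_le h n ω))
      fun m _ _ => hf0 m
  have hle2 := div_le_div_of_nonneg_right (div_le_div_of_nonneg_right hle
    (Nat.cast_nonneg (α := ℝ) n)) h0.le
  rw [sub_div, sub_div, mul_div_right_comm, mul_div_cancel_right₀ _ h0.ne']
  linarith

lemma tendsto_lag (h0 : 0 < α) (h1 : α < 1) :
    Tendsto (fun j : ℕ => 1 / √(((Nat.sqrt j : ℕ) + 1) * (α * (1 - α)))) atTop (𝓝 0) := by
  have hpos : 0 < α * (1 - α) := mul_pos h0 (sub_pos.2 h1)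
  have hr : Tendsto Nat.sqrt atTop atTop :=
    tendsto_atTop.2 fun b => eventually_atTop.2 ⟨b ^ 2, fun n hn => Nat.le_sqrt'.2 hn⟩
  have h2 : Tendsto (fun j : ℕ => (((Nat.sqrt j : ℕ) : ℝ) + 1) * (α * (1 - α))) atTop atTop :=
    ((tendsto_natCast_atTop_atTop.comp hr).atTop_add tendsto_const_nhds).atTop_mul_const hpos
  simp only [one_div]
  exact (Real.tendsto_sqrt_atTop.comp h2).inv_tendsto_atTop

/-- The centred class indicator is minus a difference of the sawtooth of `fwd_mod`, so its partial
sums telescope and stay bounded by `1`. -/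
lemma tendsto_avg_classInd {R : ℕ} (hR : 0 < R) (s : ℕ) :
    Tendsto (fun n : ℕ => (∑ j ∈ Finset.range n, classInd R s j) / (n : ℝ)) atTop
      (𝓝 (1 / R)) := by
  have hb : ∀ n : ℕ, |∑ j ∈ Finset.range n, (classInd R s j - 1 / R)| ≤ 1 := by
    intro n
    obtain ⟨m, hm⟩ : ∃ m : ℕ → ℝ, m = fun y => (((y + s + (R - 1)) % R : ℕ) : ℝ) / R := ⟨_, rfl⟩
    have e : ∀ j, classInd R s j - 1 / R = -(m (j + 1) - m j) := fun j => by
      have := fwd_mod hR s j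
      rw [← hm, fwd] at this
      rw [this]
      ring
    have hb : ∀ y, 0 ≤ m y ∧ m y ≤ 1 := fun y => by
      rw [hm]
      refine ⟨by positivity, ?_⟩
      rw [div_le_one (by positivity)]
      exact_mod_cast (Nat.mod_lt _ hR).le
    rw [Finset.sum_congr rfl fun j _ => e j, Finset.sum_neg_distrib, Finset.sum_range_sub, abs_neg,
      abs_le]
    constructor <;> linarith [(hb n).1, (hb n).2, (hb 0).1, (hb 0).2]
  have h1 : Tendsto (fun n : ℕ => (∑ j ∈ Finset.range n, (classInd R s j - 1 / R)) / (n : ℝ))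
      atTop (𝓝 0) := by
    refine squeeze_zero_norm (fun n => ?_) tendsto_one_div_atTop_nhds_zero_nat
    rw [norm_div, Real.norm_natCast]
    exact div_le_div_of_nonneg_right (hb n) (Nat.cast_nonneg _)
  have h2 := h1.add_const (1 / (R : ℝ))
  rw [zero_add] at h2
  refine h2.congr' ?_
  filter_upwards [eventually_ne_atTop 0] with n hn
  have : (n : ℝ) ≠ 0 := by exact_mod_cast hn
  rw [Finset.sum_sub_distrib, Finset.sum_const, Finset.card_range, nsmul_eq_mul]
  field_simp
  ring

/-- The walk and the time are jointly equidistributed modulo `R`. -/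
theorem IsBernoulliSeq.ae_tendsto_classInd (h : IsBernoulliSeq α η μ) (h0 : 0 < α) (h1 : α < 1)
    {R : ℕ} (hR : 0 < R) (s u : ℕ) :
    ∀ᵐ ω ∂μ, Tendsto (fun n : ℕ => (∑ j ∈ Finset.range n,
      classInd R s j * classInd R u (incr η 0 j ω)) / (n : ℝ)) atTop (𝓝 (1 / R * (1 / R))) := by
  have hb0 := classInd_nonneg R
  have hb1 := classInd_le_one R
  filter_upwards [h.ae_tendsto_avg_sub_iter h0.le h1.le
    (ψ := fun j => classInd R s j • classInd R u)
    (fun j y => mul_nonneg (hb0 _ _) (hb0 _ _))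
    (fun j y => mul_le_one₀ (hb1 _ _) (hb0 _ _) (hb1 _ _))] with ω hω
  simp_rw [iter_smul, Pi.smul_apply, smul_eq_mul] at hω
  -- The factor depending on time is deterministic, so it passes through the conditional
  -- expectation; only the class of the walk is equidistributed.
  have hT : Tendsto (fun j : ℕ => classInd R s j * ((stepOp α)^[Nat.sqrt j] (classInd R u)
      (incr η 0 (j - Nat.sqrt j) ω) - 1 / R)) atTop (𝓝 0) := by
    refine squeeze_zero_norm (fun j => ?_) (tendsto_lag h0 h1)
    rw [norm_mul, Real.norm_of_nonneg (hb0 _ _)]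
    exact (mul_le_of_le_one_left (norm_nonneg _) (hb1 _ _)).trans
      (abs_iter_classInd_sub_le h0 h1 hR u _ _)
  have h3 := (hω.add hT.cesaro).add ((tendsto_avg_classInd hR s).mul_const (1 / (R : ℝ)))
  rw [zero_add, zero_add] at h3
  refine h3.congr fun n => ?_
  rw [inv_mul_eq_div, ← add_div, ← Finset.sum_add_distrib, div_mul_eq_mul_div, ← add_div,
    Finset.sum_mul, ← Finset.sum_add_distrib]
  congr 1
  exact Finset.sum_congr rfl fun j _ => by ring

end Visits

/-! ### Large primes dividing both the time and the position -/

section CommonDivisors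

lemma iter_sum {ι : Type*} (α : ℝ) (n : ℕ) (s : Finset ι) (φ : ι → ℕ → ℝ) :
    (stepOp α)^[n] (∑ i ∈ s, φ i) = ∑ i ∈ s, (stepOp α)^[n] (φ i) := by
  classical
  induction s using Finset.induction_on with
  | empty =>
    rw [Finset.sum_empty, Finset.sum_empty]
    exact iter_const α 0 n
  | insert a s ha ih => rw [Finset.sum_insert ha, Finset.sum_insert ha, iter_add, ih]

lemma card_primeFactors_mul_log_two_le {j : ℕ} (hj : j ≠ 0) :
    (j.primeFactors.card : ℝ) * Real.log 2 ≤ Real.log j := by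
  have h1 : 2 ^ j.primeFactors.card ≤ j :=
    (Finset.pow_card_le_prod _ _ _ fun p hp => (Nat.prime_of_mem_primeFactors hp).two_le).trans
      (Nat.le_of_dvd (Nat.pos_of_ne_zero hj) (Nat.prod_primeFactors_dvd j))
  rw [← Real.log_pow]
  exact Real.log_le_log (by positivity) (by exact_mod_cast h1)

/-- The equidistribution error after `√j` steps is `O(j^(-1/4))`; summed over the `O(log j)` primes
dividing `j` it still vanishes. -/
lemma tendsto_card_primeFactors_mul_lag {α : ℝ} (h0 : 0 < α) (h1 : α < 1) :
    Tendsto (fun j : ℕ => (j.primeFactors.card : ℝ)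
      * (1 / √(((Nat.sqrt j : ℕ) + 1) * (α * (1 - α))))) atTop (𝓝 0) := by
  have hpos : 0 < α * (1 - α) := mul_pos h0 (sub_pos.2 h1)
  have hl := ((isLittleO_log_rpow_atTop (r := 1 / 4) (by norm_num)).tendsto_div_nhds_zero).comp
    tendsto_natCast_atTop_atTop
  have hl2 := hl.const_mul (1 / (Real.log 2 * √(α * (1 - α))))
  rw [mul_zero] at hl2
  refine squeeze_zero' (Eventually.of_forall fun j => by positivity) ?_ hl2
  filter_upwards [eventually_ge_atTop 1] with j hj
  have hlog2 : 0 < Real.log 2 := Real.log_pos (by norm_num)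
  have hjpos : (0 : ℝ) < j := by exact_mod_cast hj
  have hc := card_primeFactors_mul_log_two_le (j := j) (by omega)
  have hq : (j : ℝ) ^ (1 / 4 : ℝ) ≤ √((Nat.sqrt j : ℕ) + 1) := by
    refine Real.le_sqrt_of_sq_le ?_
    have e : ((j : ℝ) ^ (1 / 4 : ℝ)) ^ 2 = √j := by
      rw [← Real.rpow_natCast, ← Real.rpow_mul hjpos.le, Real.sqrt_eq_rpow]
      norm_num
    rw [e]
    refine Real.sqrt_le_iff.2 ⟨by positivity, ?_⟩
    have := Nat.lt_succ_sqrt' j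
    exact_mod_cast this.le
  have hqpos : 0 < (j : ℝ) ^ (1 / 4 : ℝ) := Real.rpow_pos_of_pos hjpos _
  have hcc : 0 < √(α * (1 - α)) := Real.sqrt_pos.2 hpos
  rw [Real.sqrt_mul (by positivity), Function.comp_apply, mul_one_div, ← mul_div_assoc,
    div_mul_eq_mul_div, one_mul, div_div, div_le_div_iff₀ (by positivity) (by positivity)]
  calc (j.primeFactors.card : ℝ) * (Real.log 2 * √(α * (1 - α)) * (j : ℝ) ^ (1 / 4 : ℝ))
      = ((j.primeFactors.card : ℝ) * Real.log 2) * (√(α * (1 - α)) * (j : ℝ) ^ (1 / 4 : ℝ)) := by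
        ring
    _ ≤ Real.log j * (√(α * (1 - α)) * √((Nat.sqrt j : ℕ) + 1)) := by gcongr
    _ = _ := by ring

open Classical in
/-- The indicator function of the event that `j` and `x` have a common prime factor that is at
least `Q`. -/
noncomputable def commonInd (Q j x : ℕ) : ℝ :=
  if ∃ p ∈ j.primeFactors, Q ≤ p ∧ p ∣ x then 1 else 0

lemma commonInd_nonneg (Q j x : ℕ) : 0 ≤ commonInd Q j x := by
  unfold commonInd; split_ifs <;> norm_num

lemma commonInd_le_one (Q j x : ℕ) : commonInd Q j x ≤ 1 := by
  unfold commonInd; split_ifs <;> norm_num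

lemma commonInd_le_sum (Q j : ℕ) :
    commonInd Q j ≤ ∑ p ∈ j.primeFactors with Q ≤ p, classInd p 0 := by
  intro x
  rw [Finset.sum_apply, commonInd]
  split_ifs with h
  · obtain ⟨p, hp, hQ, hpx⟩ := h
    have e : classInd p 0 x = 1 := by rw [classInd, add_zero, if_pos hpx]
    rw [← e]
    exact Finset.single_le_sum (f := fun p => classInd p 0 x)
      (fun p _ => classInd_nonneg p 0 x) (Finset.mem_filter.2 ⟨hp, hQ⟩)
  · exact Finset.sum_nonneg fun p _ => classInd_nonneg p 0 x

/-- The tail of the series `∑ 1 / k ^ 2`. -/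
noncomputable def sqTail (Q : ℕ) : ℝ := ∑' k : ℕ, 1 / ((k + Q : ℕ) : ℝ) ^ 2

lemma tendsto_sqTail : Tendsto sqTail atTop (𝓝 0) :=
  tendsto_sum_nat_add fun k : ℕ => 1 / (k : ℝ) ^ 2

/-- After interchanging the sums, each `p ≥ Q` divides at most `n / p` of the nonzero `j < n`, and
so contributes at most `n / p ^ 2`; `j = 0` has no prime factors. -/
lemma sum_inv_primeFactors_le (Q n : ℕ) :
    ∑ j ∈ Finset.range n, ∑ p ∈ j.primeFactors with Q ≤ p, 1 / (p : ℝ) ≤ n * sqTail Q := by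
  have h1 : ∀ j ∈ Finset.range n, ∑ p ∈ j.primeFactors with Q ≤ p, 1 / (p : ℝ)
      ≤ ∑ p ∈ Finset.Ico Q n, if j ≠ 0 ∧ p ∣ j then 1 / (p : ℝ) else 0 := by
    intro j hj
    rw [← Finset.sum_filter]
    refine Finset.sum_le_sum_of_subset_of_nonneg (fun p hp => ?_) fun p _ _ => by positivity
    simp only [Finset.mem_filter, Nat.mem_primeFactors, Finset.mem_Ico, Finset.mem_range] at *
    exact ⟨⟨hp.2, (Nat.le_of_dvd (Nat.pos_of_ne_zero hp.1.2.2) hp.1.2.1).trans_lt hj⟩,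
      hp.1.2.2, hp.1.2.1⟩
  refine (Finset.sum_le_sum h1).trans ?_
  rw [Finset.sum_comm]
  have h2 : ∀ p ∈ Finset.Ico Q n, (∑ j ∈ Finset.range n, if j ≠ 0 ∧ p ∣ j then 1 / (p : ℝ) else 0)
      ≤ n * (1 / (p : ℝ) ^ 2) := by
    intro p _
    rw [← Finset.sum_filter, Finset.sum_const, nsmul_eq_mul]
    have hc : ((Finset.range n).filter fun j => j ≠ 0 ∧ p ∣ j).card ≤ n / p := by
      rw [← Nat.card_multiples']
      exact Finset.card_le_card (Finset.filter_subset_filter _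
        (Finset.range_subset_range.2 (Nat.le_succ n)))
    have hc2 : (((Finset.range n).filter fun j => j ≠ 0 ∧ p ∣ j).card : ℝ) ≤ (n : ℝ) / p :=
      (Nat.cast_le.2 hc).trans Nat.cast_div_le
    refine (mul_le_mul_of_nonneg_right hc2 (by positivity)).trans_eq ?_
    rw [mul_one_div, mul_one_div, div_div, sq]
  refine (Finset.sum_le_sum h2).trans ?_
  rw [← Finset.mul_sum, Finset.sum_Ico_eq_sum_range]
  refine mul_le_mul_of_nonneg_left ?_ (Nat.cast_nonneg _)
  have hs : Summable fun k : ℕ => 1 / ((k + Q : ℕ) : ℝ) ^ 2 :=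
    (summable_nat_add_iff (f := fun k : ℕ => 1 / (k : ℝ) ^ 2) Q).2
      (Real.summable_one_div_nat_pow.2 (by norm_num))
  simp_rw [add_comm Q]
  exact hs.sum_le_tsum _ fun k _ => by positivity

variable {Ω : Type*} [MeasurableSpace Ω] {μ : Measure Ω} [IsProbabilityMeasure μ]
  {α : ℝ} {η : ℕ → Ω → ℕ}

/-- The walk and the time rarely have a large common prime factor. -/
theorem IsBernoulliSeq.ae_avg_commonInd_le (h : IsBernoulliSeq α η μ) (h0 : 0 < α) (h1 : α < 1)
    (Q : ℕ) :
    ∀ᵐ ω ∂μ, ∃ u : ℕ → ℝ, Tendsto u atTop (𝓝 0) ∧ ∀ n : ℕ,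
      (∑ j ∈ Finset.range n, commonInd Q j (incr η 0 j ω)) / (n : ℝ) ≤ sqTail Q + u n := by
  filter_upwards [h.ae_tendsto_avg_sub_iter h0.le h1.le (ψ := commonInd Q)
    (commonInd_nonneg Q) (commonInd_le_one Q)] with ω hω
  have hc := (tendsto_card_primeFactors_mul_lag h0 h1).cesaro
  have hadd := hω.add hc
  rw [zero_add] at hadd
  refine ⟨_, hadd, fun n => ?_⟩
  -- A union bound over the primes of `j`. The primes may be as large as `j`, far beyond the `√j`
  -- steps taken, so uniformity in the modulus is essential.
  have hiter : ∀ j x, (stepOp α)^[Nat.sqrt j] (commonInd Q j) x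
      ≤ (∑ p ∈ j.primeFactors with Q ≤ p, 1 / (p : ℝ))
        + (j.primeFactors.card : ℝ) * (1 / √(((Nat.sqrt j : ℕ) + 1) * (α * (1 - α)))) := by
    intro j x
    refine (iter_mono h0.le h1.le _ (commonInd_le_sum Q j) x).trans ?_
    rw [iter_sum, Finset.sum_apply]
    have hp : ∀ p ∈ j.primeFactors.filter (Q ≤ ·),
        (stepOp α)^[Nat.sqrt j] (classInd p 0) x
          ≤ 1 / (p : ℝ) + 1 / √(((Nat.sqrt j : ℕ) + 1) * (α * (1 - α))) := by
      intro p hp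
      have := abs_iter_classInd_sub_le h0 h1
        (Nat.pos_of_mem_primeFactors (Finset.mem_filter.1 hp).1) 0 (Nat.sqrt j) x
      linarith [(abs_le.1 this).2]
    refine (Finset.sum_le_sum hp).trans ?_
    rw [Finset.sum_add_distrib, Finset.sum_const, nsmul_eq_mul]
    gcongr
    exact Finset.filter_subset _ _
  have hsum := Finset.sum_le_sum fun j (_ : j ∈ Finset.range n) =>
    hiter j (incr η 0 (j - Nat.sqrt j) ω)
  rw [Finset.sum_add_distrib] at hsum
  have hdet : (∑ j ∈ Finset.range n, ∑ p ∈ j.primeFactors with Q ≤ p, 1 / (p : ℝ)) / n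
      ≤ sqTail Q := by
    rcases Nat.eq_zero_or_pos n with rfl | hn
    · simp only [Nat.cast_zero, div_zero]
      exact tsum_nonneg fun k => by positivity
    · rw [div_le_iff₀ (by exact_mod_cast hn), mul_comm]
      exact sum_inv_primeFactors_le Q n
  have hdiv := div_le_div_of_nonneg_right hsum (Nat.cast_nonneg (α := ℝ) n)
  rw [add_div] at hdiv
  rw [inv_mul_eq_div, Finset.sum_sub_distrib, sub_div]
  linarith

end CommonDivisors

/-! ### Densities of sieved multiples by the Chinese remainder theorem -/

section LocalDensities

/-- The mean value of `φ` over `0, …, R - 1`. -/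
noncomputable def periodMean (R : ℕ) (φ : ℕ → ℝ) : ℝ := (∑ m ∈ Finset.range R, φ m) / R

lemma sum_range_mul_of_periodic {M : ℕ} {φ : ℕ → ℝ} (hφ : Function.Periodic φ M) (k : ℕ) :
    ∑ m ∈ Finset.range (M * k), φ m = k * ∑ m ∈ Finset.range M, φ m := by
  induction k with
  | zero => simp
  | succ k ih =>
    have hp : ∀ x, φ (M * k + x) = φ x := fun x => by
      have := hφ.nat_mul k x
      rw [Nat.cast_id, mul_comm, add_comm] at this
      exact this
    rw [mul_add, mul_one, Finset.sum_range_add, ih, Finset.sum_congr rfl fun x _ => hp x]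
    push_cast
    ring

lemma mean_mul_period {M k : ℕ} (hk : 0 < k) {φ : ℕ → ℝ}
    (hφ : Function.Periodic φ M) : periodMean (M * k) φ = periodMean M φ := by
  have hk' : (k : ℝ) ≠ 0 := by positivity
  rw [periodMean, periodMean, sum_range_mul_of_periodic hφ, Nat.cast_mul, mul_comm (M : ℝ),
    mul_div_mul_left _ _ hk']

lemma mean_eq_of_periodic {M N : ℕ} (hM : 0 < M) (hN : 0 < N) {φ : ℕ → ℝ}
    (hφM : Function.Periodic φ M) (hφN : Function.Periodic φ N) : periodMean M φ = periodMean N φ := by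
  rw [← mean_mul_period hN hφM, mul_comm, mean_mul_period hM hφN]

/-- Functions with coprime periods are independent. -/
lemma mean_mul_of_coprime {M N : ℕ} (hM : 0 < M) (hN : 0 < N) (hMN : M.Coprime N) {φ ψ : ℕ → ℝ}
    (hφ : Function.Periodic φ M) (hψ : Function.Periodic ψ N) :
    periodMean (M * N) (fun m => φ m * ψ m) = periodMean M φ * periodMean N ψ := by
  have key : ∑ m ∈ Finset.range (M * N), φ m * ψ m
      = ∑ p ∈ Finset.range M ×ˢ Finset.range N, φ p.1 * ψ p.2 := by
    refine Finset.sum_nbij (fun m => (m % M, m % N)) ?_ ?_ ?_ ?_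
    · intro m _
      exact Finset.mem_product.2 ⟨Finset.mem_range.2 (Nat.mod_lt _ hM),
        Finset.mem_range.2 (Nat.mod_lt _ hN)⟩
    · intro m hm m' hm' h
      simp only [Finset.coe_range, Set.mem_Iio, Prod.mk.injEq] at hm hm' h
      exact Nat.ModEq.eq_of_lt_of_lt ((Nat.modEq_and_modEq_iff_modEq_mul hMN).1 ⟨h.1, h.2⟩) hm hm'
    · rintro ⟨a, b⟩ hab
      simp only [Finset.coe_product, Finset.coe_range, Set.mem_prod, Set.mem_Iio] at hab
      refine ⟨Nat.chineseRemainder hMN a b, ?_, ?_⟩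
      · exact Finset.mem_coe.2 (Finset.mem_range.2
          (Nat.chineseRemainder_lt_mul hMN a b hM.ne' hN.ne'))
      · have h1 := (Nat.chineseRemainder hMN a b).2.1
        have h2 := (Nat.chineseRemainder hMN a b).2.2
        simp only [Prod.mk.injEq]
        exact ⟨Eq.trans h1 (Nat.mod_eq_of_lt hab.1), Eq.trans h2 (Nat.mod_eq_of_lt hab.2)⟩
    · intro m _
      rw [hφ.map_mod_nat, hψ.map_mod_nat]
  rw [periodMean, periodMean, periodMean, key, Finset.sum_product, ← Finset.sum_mul_sum, Nat.cast_mul,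
    mul_div_mul_comm]

open Classical in
/-- The indicator function of the multiples of `r` that are not congruent to an element of `H`
modulo an element of `T`. -/
noncomputable def siftInd (H : Finset ℤ) (T : Finset ℕ) (r m : ℕ) : ℝ :=
  if r ∣ m ∧ ∀ g ∈ T, ∀ h ∈ H, ¬ ((m : ℤ) ≡ h [ZMOD (g : ℤ)]) then 1 else 0

lemma siftInd_periodic {H : Finset ℤ} {T : Finset ℕ} {r R : ℕ} (hr : r ∣ R)
    (hT : ∀ g ∈ T, g ∣ R) : Function.Periodic (siftInd H T r) R := by
  intro m
  have h1 : r ∣ m + R ↔ r ∣ m := (Nat.dvd_add_iff_left hr).symm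
  have h2 : ∀ g ∈ T, ∀ h : ℤ, ((m + R : ℕ) : ℤ) ≡ h [ZMOD (g : ℤ)] ↔ (m : ℤ) ≡ h [ZMOD (g : ℤ)] := by
    intro g hg h
    have : ((m + R : ℕ) : ℤ) ≡ (m : ℤ) [ZMOD (g : ℤ)] := by
      obtain ⟨k, rfl⟩ := hT g hg
      push_cast
      exact Int.modEq_iff_dvd.2 ⟨-k, by ring⟩
    exact ⟨fun a => this.symm.trans a, fun a => this.trans a⟩
  simp only [siftInd]
  refine if_congr (and_congr h1 (forall₂_congr fun g hg => forall₂_congr fun h _ => ?_)) rfl rfl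
  rw [h2 g hg]

lemma kappa_one (H : Finset ℤ) (g : ℕ) : kappa H g 1 = nu H g := by
  simp [kappa, nu]

lemma intCast_eq_natCast_iff (g : ℕ) (h : ℤ) (m : ℕ) :
    (h : ZMod g) = (m : ZMod g) ↔ (m : ℤ) ≡ h [ZMOD (g : ℤ)] := by
  rw [eq_comm, ← Int.cast_natCast, ZMod.intCast_eq_intCast_iff]

lemma card_multiples_range {e g : ℕ} (hg : 0 < g) (he : e ∣ g) :
    ((Finset.range g).filter fun c => e ∣ c).card = g / e := by
  obtain ⟨k, rfl⟩ := he
  have he : 0 < e := Nat.pos_of_mul_pos_right hg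
  have : (Finset.range (e * k)).filter (fun c => e ∣ c) = (Finset.range k).image (e * ·) := by
    ext c
    simp only [Finset.mem_filter, Finset.mem_range, Finset.mem_image]
    constructor
    · rintro ⟨hc, d, rfl⟩
      exact ⟨d, Nat.lt_of_mul_lt_mul_left hc, rfl⟩
    · rintro ⟨d, hd, rfl⟩
      exact ⟨Nat.mul_lt_mul_of_pos_left hd he, dvd_mul_right _ _⟩
  rw [this, Finset.card_image_of_injective _ (mul_right_injective₀ he.ne'), Finset.card_range,
    Nat.mul_div_cancel_left _ he]

open Classical in
-- Since `e ∣ g`, divisibility by `e` depends only on the class modulo `g`: a class of multiples of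
-- `e` is occupied only by multiples of `e`.
lemma card_occupied {e g : ℕ} (hg : 0 < g) (he : e ∣ g) (H : Finset ℤ) :
    ((Finset.range g).filter fun c : ℕ => e ∣ c ∧ ∃ h ∈ H, (c : ℤ) ≡ h [ZMOD (g : ℤ)]).card
      = kappa H g e := by
  have : NeZero g := ⟨hg.ne'⟩
  have heg : (e : ℤ) ∣ g := by exact_mod_cast he
  rw [kappa, ← Finset.card_image_of_injOn (f := fun c : ℕ => (c : ZMod g))]
  · congr 1
    ext z
    simp only [Finset.mem_image, Finset.mem_filter, Finset.mem_range]
    constructor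
    · rintro ⟨c, ⟨_, hec, h, hh, hch⟩, rfl⟩
      refine ⟨h, ⟨hh, ?_⟩, (intCast_eq_natCast_iff g h c).2 hch⟩
      have h1 : (e : ℤ) ∣ c := by exact_mod_cast hec
      exact (dvd_sub_left h1).1 (heg.trans (Int.modEq_iff_dvd.1 hch))
    · rintro ⟨h, ⟨hh, heh⟩, rfl⟩
      refine ⟨(h : ZMod g).val, ⟨ZMod.val_lt _, ?_, h, hh, ?_⟩, ZMod.natCast_zmod_val _⟩
      · have hch : (((h : ZMod g).val : ℕ) : ℤ) ≡ h [ZMOD (g : ℤ)] :=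
          (intCast_eq_natCast_iff g h _).1 (ZMod.natCast_zmod_val _).symm
        have := (dvd_sub_right heh).1 (heg.trans (Int.modEq_iff_dvd.1 hch))
        exact_mod_cast this
      · exact (intCast_eq_natCast_iff g h _).1 (ZMod.natCast_zmod_val _).symm
  · intro c hc c' hc' h
    simp only [Finset.coe_filter, Finset.mem_range, Set.mem_ofPred_eq] at hc hc'
    exact Nat.ModEq.eq_of_lt_of_lt ((ZMod.natCast_eq_natCast_iff _ _ _).1 h) hc.1 hc'.1

lemma kappa_mul_le {e g : ℕ} (hg : 0 < g) (he : e ∣ g) (H : Finset ℤ) : e * kappa H g e ≤ g := by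
  classical
  have h1 := card_occupied hg he H
  have h2 := card_multiples_range hg he
  have h3 : kappa H g e ≤ g / e := by
    rw [← h1, ← h2]
    exact Finset.card_le_card (Finset.monotone_filter_right _ fun c _ hc => hc.1)
  exact (Nat.mul_le_mul_left e h3).trans (Nat.mul_div_le g e)

lemma mean_siftInd_singleton {e g : ℕ} (hg : 0 < g) (he : e ∣ g) (H : Finset ℤ) :
    periodMean g (siftInd H {g} e) = 1 / e * (1 - (e : ℝ) * kappa H g e / g) := by
  classical
  have hgR : (g : ℝ) ≠ 0 := by positivity
  have heR : (e : ℝ) ≠ 0 := by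
    have := Nat.pos_of_dvd_of_pos he hg
    positivity
  have e1 : (∑ m ∈ Finset.range g, siftInd H {g} e m)
      = (((Finset.range g).filter fun c => e ∣ c).card : ℝ)
        - (((Finset.range g).filter fun c : ℕ =>
          e ∣ c ∧ ∃ h ∈ H, (c : ℤ) ≡ h [ZMOD (g : ℤ)]).card : ℝ) := by
    rw [Finset.card_filter, Finset.card_filter]
    push_cast
    rw [← Finset.sum_sub_distrib]
    refine Finset.sum_congr rfl fun c _ => ?_
    simp only [siftInd, Finset.mem_singleton, forall_eq]
    by_cases h1 : e ∣ c
    · by_cases h2 : ∃ h ∈ H, (c : ℤ) ≡ h [ZMOD (g : ℤ)]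
      · rw [if_neg, if_pos h1, if_pos ⟨h1, h2⟩, sub_self]
        rintro ⟨_, h3⟩
        obtain ⟨h, hh, hc⟩ := h2
        exact h3 h hh hc
      · rw [if_pos, if_pos h1, if_neg fun h => h2 h.2, sub_zero]
        exact ⟨h1, fun h hh hc => h2 ⟨h, hh, hc⟩⟩
    · simp [h1]
  rw [periodMean, e1, card_occupied hg he, card_multiples_range hg he, Nat.cast_div he heR]
  field_simp

/-- The density of the multiples of `r` that are not congruent to an element of `H` modulo an
element of `T`. -/
theorem mean_siftInd {H : Finset ℤ} {T : Finset ℕ} (hT : (T : Set ℕ).Pairwise Nat.Coprime)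
    (hT0 : ∀ g ∈ T, 0 < g) {r : ℕ} (hr : Squarefree r) {R : ℕ} (hR : 0 < R) (hrR : r ∣ R)
    (hTR : ∀ g ∈ T, g ∣ R) :
    periodMean R (siftInd H T r)
      = 1 / r * ∏ g ∈ T, (1 - (g.gcd r : ℝ) * kappa H g (g.gcd r) / g) := by
  classical
  induction T using Finset.induction_on generalizing r R with
  | empty =>
    have hr0 : 0 < r := Nat.pos_of_ne_zero hr.ne_zero
    have hrr : (r : ℝ) ≠ 0 := by positivity
    rw [mean_eq_of_periodic hR hr0 (siftInd_periodic hrR hTR) (siftInd_periodic dvd_rfl (by simp)),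
      periodMean]
    have := card_multiples_range hr0 dvd_rfl
    rw [Nat.div_self hr0, Finset.card_filter] at this
    simp only [siftInd, Finset.notMem_empty, false_imp_iff, implies_true, and_true,
      Finset.prod_empty, mul_one]
    congr 1
    exact_mod_cast this
  | insert g T hgT ih =>
    have hg0 : 0 < g := hT0 g (Finset.mem_insert_self _ _)
    have hT' : (T : Set ℕ).Pairwise Nat.Coprime :=
      hT.mono (by rw [Finset.coe_insert]; exact Set.subset_insert _ _)
    have hgcop : ∀ g' ∈ T, g.Coprime g' := fun g' hg' =>
      hT (by simp) (by simp [hg']) (fun h => hgT (h ▸ hg'))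
    have hT0' : ∀ g' ∈ T, 0 < g' := fun g' hg' => hT0 g' (Finset.mem_insert_of_mem hg')
    -- Splitting `r = gcd(g, r) * r₁` separates the condition at `g` from the others. Squarefreeness
    -- makes `r₁` coprime to the gcd, hence to `g`.
    obtain ⟨r₁, hr₁⟩ := Nat.gcd_dvd_right g r
    set e := g.gcd r with he
    have hsq : Squarefree (e * r₁) := hr₁ ▸ hr
    have hcop : e.Coprime r₁ := Nat.coprime_of_squarefree_mul hsq
    have hsq₁ : Squarefree r₁ := hsq.of_mul_right
    have hr₁0 : 0 < r₁ := Nat.pos_of_ne_zero hsq₁.ne_zero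
    have he0 : 0 < e := Nat.gcd_pos_of_pos_left _ hg0
    have hgr₁ : g.Coprime r₁ := by
      have h1 : g.gcd r₁ ∣ e := Nat.dvd_gcd (Nat.gcd_dvd_left _ _)
        ((Nat.gcd_dvd_right _ _).trans ⟨e, by rw [hr₁, mul_comm]⟩)
      exact Nat.dvd_one.1 (hcop ▸ Nat.dvd_gcd h1 (Nat.gcd_dvd_right g r₁))
    set N := r₁ * ∏ g' ∈ T, g' with hN
    have hN0 : 0 < N := Nat.mul_pos hr₁0 (Finset.prod_pos hT0')
    have hgN : g.Coprime N :=
      Nat.Coprime.mul_right hgr₁ (Nat.coprime_prod_right_iff.2 hgcop)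
    have hTN : ∀ g' ∈ T, g' ∣ N := fun g' hg' => (Finset.dvd_prod_of_mem _ hg').mul_left _
    have hp1 : Function.Periodic (siftInd H {g} e) g :=
      siftInd_periodic (Nat.gcd_dvd_left g r) (by simp)
    have hp2 : Function.Periodic (siftInd H T r₁) N := siftInd_periodic (dvd_mul_right _ _) hTN
    have hsplit : siftInd H (insert g T) r = fun m => siftInd H {g} e m * siftInd H T r₁ m := by
      ext m
      have hd : r ∣ m ↔ e ∣ m ∧ r₁ ∣ m := by
        rw [hr₁]
        exact ⟨fun h => ⟨(dvd_mul_right _ _).trans h, (dvd_mul_left _ _).trans h⟩,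
          fun h => hcop.mul_dvd_of_dvd_of_dvd h.1 h.2⟩
      simp only [siftInd, ite_zero_mul_ite_zero, mul_one]
      refine if_congr ?_ rfl rfl
      rw [hd, Finset.forall_mem_insert]
      simp only [Finset.mem_singleton, forall_eq]
      tauto
    have hgN0 : 0 < g * N := Nat.mul_pos hg0 hN0
    rw [mean_eq_of_periodic hR hgN0 (siftInd_periodic hrR hTR)
      (siftInd_periodic ?_ ?_), hsplit, mean_mul_of_coprime hg0 hN0 hgN hp1 hp2,
      mean_siftInd_singleton hg0 (Nat.gcd_dvd_left g r),
      ih hT' hT0' hsq₁ hN0 (dvd_mul_right _ _) hTN, Finset.prod_insert hgT, ← he]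
    · have hgcd : ∀ g' ∈ T, g'.gcd r₁ = g'.gcd r := fun g' hg' => by
        rw [hr₁]
        exact (Nat.Coprime.gcd_mul_left_cancel_right _ (Nat.Coprime.coprime_dvd_left
          (Nat.gcd_dvd_left g r) (hgcop g' hg'))).symm
      rw [Finset.prod_congr rfl fun g' hg' => by rw [hgcd g' hg']]
      have hrc : (r : ℝ) = e * r₁ := by exact_mod_cast hr₁
      rw [hrc, one_div, one_div, one_div, mul_inv]
      ring
    · rw [hr₁]
      exact Nat.mul_dvd_mul (Nat.gcd_dvd_left g r) (dvd_mul_right _ _)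
    · intro g' hg'
      rcases Finset.mem_insert.1 hg' with rfl | h
      · exact dvd_mul_right _ _
      · exact (hTN g' h).mul_left _

end LocalDensities

/-! ### The factor `f(r)` as a product of local corrections -/

section ArithmeticFactor

variable {G : Set ℕ} {H : Finset ℤ}

lemma Admissible.pos (hH : Admissible G H) {g : ℕ} (hg : g ∈ G) : 0 < g :=
  (Nat.zero_le _).trans_lt (hH g hg)

/-- Pairwise coprimality makes `g ↦ gcd(g, r)` injective on these `g`, with values among the
divisors of `r`. -/
lemma finite_nonCoprimeTo (hG : G.Pairwise Nat.Coprime) {r : ℕ} (hr : r ≠ 0) :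
    (nonCoprimeTo G r).Finite := by
  refine Set.Finite.of_injOn (f := fun g => g.gcd r) (t := (r.divisors : Set ℕ)) ?_ ?_
    (Finset.finite_toSet _)
  · intro g _
    exact Finset.mem_coe.2 (Nat.mem_divisors.2 ⟨Nat.gcd_dvd_right _ _, hr⟩)
  · intro g hg g' hg' h
    by_contra hne
    have hc := hG hg.1 hg'.1 hne
    have h1 : g.gcd r ∣ g.gcd g' := Nat.dvd_gcd (Nat.gcd_dvd_left _ _)
      ((show g.gcd r = g'.gcd r from h) ▸ Nat.gcd_dvd_left g' r)
    rw [hc, Nat.dvd_one] at h1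
    exact hg.2.ne' h1

lemma gcd_prod_eq {s : Finset ℕ} (hs : (s : Set ℕ).Pairwise Nat.Coprime) (r : ℕ) :
    r.gcd (∏ g ∈ s, g) = ∏ g ∈ s, g.gcd r := by
  classical
  induction s using Finset.induction_on with
  | empty => simp
  | insert a s ha ih =>
    have hs' : (s : Set ℕ).Pairwise Nat.Coprime :=
      hs.mono (by rw [Finset.coe_insert]; exact Set.subset_insert _ _)
    have hc : a.Coprime (∏ g ∈ s, g) := Nat.coprime_prod_right_iff.2 fun g hg =>
      hs (by simp) (by simp [hg]) (fun h => ha (h ▸ hg))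
    rw [Finset.prod_insert ha, Finset.prod_insert ha, Nat.Coprime.gcd_mul _ hc, ih hs',
      Nat.gcd_comm r a]

lemma gcd_prod_gcd_of_mem (hG : G.Pairwise Nat.Coprime) {S : Finset ℕ} (hS : (S : Set ℕ) ⊆ G)
    (r : ℕ) {g : ℕ} (hg : g ∈ S) : g.gcd (∏ g' ∈ S, g'.gcd r) = g.gcd r := by
  classical
  rw [← Finset.mul_prod_erase S (fun g' => g'.gcd r) hg, Nat.Coprime.gcd_mul_right_cancel_right]
  · exact Nat.gcd_eq_right (Nat.gcd_dvd_left _ _)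
  · refine (Nat.coprime_prod_right_iff.2 fun g' hg' => ?_).symm
    have h1 := Finset.mem_erase.1 hg'
    exact Nat.Coprime.coprime_dvd_right (Nat.gcd_dvd_left _ _)
      (hG (hS hg) (hS (Finset.mem_coe.2 h1.2)) h1.1.symm)

lemma gcd_prod_gcd_of_notMem (hG : G.Pairwise Nat.Coprime) {S : Finset ℕ} (hS : (S : Set ℕ) ⊆ G)
    (r : ℕ) {g : ℕ} (hgG : g ∈ G) (hg : g ∉ S) : g.gcd (∏ g' ∈ S, g'.gcd r) = 1 :=
  Nat.coprime_prod_right_iff.2 fun _ hg' => Nat.Coprime.coprime_dvd_right (Nat.gcd_dvd_left _ _)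
    (hG hgG (hS (Finset.mem_coe.2 hg')) (fun h => hg (h ▸ hg')))

/-- Recovers the subset `S` from its divisor `∏ gcd(g, r)`: distinct subsets give distinct divisors.
-/
lemma nonCoprimeTo_prod_gcd (hG : G.Pairwise Nat.Coprime) {r : ℕ} {S : Finset ℕ}
    (hS : (S : Set ℕ) ⊆ nonCoprimeTo G r) :
    nonCoprimeTo G (∏ g ∈ S, g.gcd r) = S := by
  have hSG : (S : Set ℕ) ⊆ G := fun g hg => (hS hg).1
  ext g
  constructor
  · rintro ⟨hgG, hlt⟩
    by_contra hg
    rw [gcd_prod_gcd_of_notMem hG hSG r hgG hg] at hlt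
    exact lt_irrefl _ hlt
  · intro hg
    refine ⟨hSG hg, ?_⟩
    rw [gcd_prod_gcd_of_mem hG hSG r hg]
    exact (hS hg).2

lemma omegaFactor_prod_gcd (hG : G.Pairwise Nat.Coprime) {r : ℕ} {S : Finset ℕ}
    (hS : (S : Set ℕ) ⊆ nonCoprimeTo G r) :
    omegaFactor G H (∏ g ∈ S, g.gcd r) = ∏ g ∈ S, (-(kappa H g (g.gcd r) : ℝ) / g) := by
  rw [omegaFactor, nonCoprimeTo_prod_gcd hG hS, finprod_mem_coe_finset]
  exact Finset.prod_congr rfl fun g hg => by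
    rw [gcd_prod_gcd_of_mem hG (fun g hg => (hS hg).1) r hg]

/-- A nonzero value needs, for each `g ∈ S`, some `h ∈ H` divisible by `gcd(g, r)`; these gcds are
coprime, so their product divides `∏ h`. Hence restricting to divisors of `∏ h` loses nothing. -/
lemma omegaFactor_eq_zero (hG : G.Pairwise Nat.Coprime) {r : ℕ} {S : Finset ℕ}
    (hS : (S : Set ℕ) ⊆ nonCoprimeTo G r)
    (hd : ¬ (((∏ g ∈ S, g.gcd r : ℕ) : ℤ) ∣ ∏ h ∈ H, h)) :
    omegaFactor G H (∏ g ∈ S, g.gcd r) = 0 := by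
  rw [omegaFactor_prod_gcd hG hS]
  by_contra hne
  rw [← ne_eq, Finset.prod_ne_zero_iff] at hne
  refine hd ?_
  push_cast
  refine Finset.prod_dvd_of_coprime ?_ ?_
  · intro g hg g' hg' hgg
    exact Nat.isCoprime_iff_coprime.2 (Nat.Coprime.of_dvd (Nat.gcd_dvd_left _ _)
      (Nat.gcd_dvd_left _ _) (hG (hS hg).1 (hS hg').1 hgg))
  · intro g hg
    have h1 : (H.filter fun h : ℤ => ((g.gcd r : ℕ) : ℤ) ∣ h).Nonempty := by
      rw [Finset.nonempty_iff_ne_empty]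
      intro h0
      refine hne g hg ?_
      rw [kappa, h0]
      simp
    obtain ⟨h, hh⟩ := h1
    rw [Finset.mem_filter] at hh
    exact hh.2.trans (Finset.dvd_prod_of_mem _ hh.1)

/-- Expanding the product gives a sum over subsets of `N`. Subsets correspond to the divisors `(r,
a)`, and those excluded by the condition on `∏ h` have `ω = 0`. -/
lemma sum_sieveDivisors (hG : G.Pairwise Nat.Coprime) {r : ℕ} (hr : r ≠ 0) {N : Finset ℕ}
    (hN : (N : Set ℕ) = nonCoprimeTo G r) :
    ∑ d ∈ sieveDivisors G H r, (d : ℝ) * omegaFactor G H d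
      = ∏ g ∈ N, (1 - (g.gcd r : ℝ) * kappa H g (g.gcd r) / g) := by
  classical
  have hsub : ∀ S ∈ N.powerset, (S : Set ℕ) ⊆ nonCoprimeTo G r := fun S hS => by
    rw [← hN]
    exact Finset.coe_subset.2 (Finset.mem_powerset.1 hS)
  have e1 : ∏ g ∈ N, (1 - (g.gcd r : ℝ) * kappa H g (g.gcd r) / g)
      = ∑ S ∈ N.powerset, ((∏ g ∈ S, g.gcd r : ℕ) : ℝ)
        * omegaFactor G H (∏ g ∈ S, g.gcd r) := by
    have : ∀ g ∈ N, (1 - (g.gcd r : ℝ) * kappa H g (g.gcd r) / g)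
        = 1 + (g.gcd r : ℝ) * (-(kappa H g (g.gcd r) : ℝ) / g) := fun g _ => by ring
    rw [Finset.prod_congr rfl this, Finset.prod_one_add]
    refine Finset.sum_congr rfl fun S hS => ?_
    rw [omegaFactor_prod_gcd hG (hsub S hS), Nat.cast_prod, Finset.prod_mul_distrib]
  have hinj : Set.InjOn (fun S : Finset ℕ => ∏ g ∈ S, g.gcd r) (N.powerset : Set (Finset ℕ)) := by
    intro S hS S' hS' h
    have h1 := nonCoprimeTo_prod_gcd hG (hsub S hS)
    have h2 := nonCoprimeTo_prod_gcd hG (hsub S' hS')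
    have h3 : ∏ g ∈ S, g.gcd r = ∏ g ∈ S', g.gcd r := h
    rw [h3, h2] at h1
    exact (Finset.coe_injective h1).symm
  rw [e1, ← Finset.sum_image (g := fun S : Finset ℕ => ∏ g ∈ S, g.gcd r)
    (f := fun d : ℕ => (d : ℝ) * omegaFactor G H d) hinj]
  refine Finset.sum_subset ?_ ?_
  · intro d hd
    rw [sieveDivisors, Finset.mem_filter] at hd
    obtain ⟨_, _, a, ⟨s, hsG, rfl⟩, rfl⟩ := hd
    refine Finset.mem_image.2 ⟨s.filter fun g => 1 < g.gcd r, ?_, ?_⟩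
    · refine Finset.mem_powerset.2 (Finset.coe_subset.1 ?_)
      rw [hN]
      intro g hg
      have := Finset.mem_filter.1 (Finset.mem_coe.1 hg)
      exact ⟨hsG this.1, this.2⟩
    · rw [gcd_prod_eq (hG.mono hsG)]
      refine Finset.prod_subset (Finset.filter_subset _ _) fun g hg hg' => ?_
      have h1 : 0 < g.gcd r := Nat.gcd_pos_of_pos_right _ (Nat.pos_of_ne_zero hr)
      have h2 : ¬ 1 < g.gcd r := fun h => hg' (Finset.mem_filter.2 ⟨hg, h⟩)
      omega
  · intro d hd hd'
    obtain ⟨S, hS, rfl⟩ := Finset.mem_image.1 hd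
    have hSG : (S : Set ℕ) ⊆ G := fun g hg => (hsub S hS hg).1
    rw [omegaFactor_eq_zero hG (hsub S hS), mul_zero]
    intro hdvd
    refine hd' ?_
    rw [sieveDivisors, Finset.mem_filter]
    have e2 := gcd_prod_eq (hG.mono hSG) r
    refine ⟨Nat.mem_divisors.2 ⟨?_, hr⟩, hdvd, _, ⟨S, hSG, rfl⟩, e2.symm⟩
    rw [← e2]
    exact Nat.gcd_dvd_left _ _

open Classical in
/-- The density of the numbers allowed modulo `g` among the multiples of `r`. -/
noncomputable def localFactor (G : Set ℕ) (H : Finset ℤ) (r g : ℕ) : ℝ :=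
  if g ∈ G then 1 - (g.gcd r : ℝ) * kappa H g (g.gcd r) / g else 1

lemma localFactor_nonneg (hH : Admissible G H) (r g : ℕ) : 0 ≤ localFactor G H r g := by
  unfold localFactor
  split_ifs with hg
  · have h1 := kappa_mul_le (hH.pos hg) (Nat.gcd_dvd_left g r) H
    have h2 : (g.gcd r : ℝ) * kappa H g (g.gcd r) / g ≤ 1 :=
      div_le_one_of_le₀ (by exact_mod_cast h1) (Nat.cast_nonneg _)
    linarith
  · exact zero_le_one

lemma localFactor_le_one (r g : ℕ) : localFactor G H r g ≤ 1 := by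
  unfold localFactor
  split_ifs with hg
  · have : 0 ≤ (g.gcd r : ℝ) * kappa H g (g.gcd r) / g := by positivity
    linarith
  · exact le_rfl

lemma localFactor_one_of_mem {g : ℕ} (hg : g ∈ G) :
    localFactor G H 1 g = 1 - (nu H g : ℝ) / g := by
  simp [localFactor, hg, kappa_one]

lemma localFactor_one_pos (hH : Admissible G H) (g : ℕ) : 0 < localFactor G H 1 g := by
  by_cases hg : g ∈ G
  · have h0 : (0 : ℝ) < g := by exact_mod_cast hH.pos hg
    rw [localFactor_one_of_mem hg, sub_pos, div_lt_one h0]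
    exact_mod_cast hH g hg
  · simp [localFactor, hg]

lemma localFactor_eq_of_notMem {r g : ℕ} (hr : r ≠ 0) (hg : g ∉ nonCoprimeTo G r) :
    localFactor G H r g = localFactor G H 1 g := by
  unfold localFactor
  split_ifs with h
  · have h1 : 0 < g.gcd r := Nat.gcd_pos_of_pos_right _ (Nat.pos_of_ne_zero hr)
    have h2 : ¬ 1 < g.gcd r := fun h' => hg ⟨h, h'⟩
    have h3 : g.gcd r = 1 := by omega
    rw [h3, Nat.gcd_one_right]
  · rfl

/-- Shows that `f(r)` is the correction from the density among all integers to the density among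
multiples of `r`. -/
lemma fFactor_eq (hG : G.Pairwise Nat.Coprime) {r : ℕ} (hr : r ≠ 0) {N : Finset ℕ}
    (hN : (N : Set ℕ) = nonCoprimeTo G r) :
    fFactor G H r = ∏ g ∈ N, (localFactor G H 1 g)⁻¹ * localFactor G H r g := by
  have hmem : ∀ g ∈ N, g ∈ G := fun g hg => by
    have : g ∈ nonCoprimeTo G r := hN ▸ Finset.mem_coe.2 hg
    exact this.1
  rw [fFactor, sum_sieveDivisors hG hr hN, ← hN, finprod_mem_coe_finset, ← Finset.prod_mul_distrib]
  refine Finset.prod_congr rfl fun g hg => ?_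
  rw [localFactor_one_of_mem (hmem g hg), localFactor, if_pos (hmem g hg)]

/-- The density of the numbers allowed modulo all `g < Q` in `G` among the multiples of `r`. -/
noncomputable def partialDensity (G : Set ℕ) (H : Finset ℤ) (Q r : ℕ) : ℝ :=
  ∏ g ∈ Finset.range Q, localFactor G H r g

lemma partialDensity_nonneg (hH : Admissible G H) (Q r : ℕ) : 0 ≤ partialDensity G H Q r :=
  Finset.prod_nonneg fun _ _ => localFactor_nonneg hH _ _

lemma partialDensity_le_one (hH : Admissible G H) (Q r : ℕ) : partialDensity G H Q r ≤ 1 :=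
  Finset.prod_le_one (fun _ _ => localFactor_nonneg hH _ _) fun _ _ => localFactor_le_one _ _

lemma partialDensity_eq (hG : G.Pairwise Nat.Coprime) (hH : Admissible G H) {r : ℕ}
    (hr : r ≠ 0) :
    ∀ᶠ Q in atTop, partialDensity G H Q r = partialDensity G H Q 1 * fFactor G H r := by
  classical
  set N := (finite_nonCoprimeTo hG hr).toFinset with hN
  have hNc : (N : Set ℕ) = nonCoprimeTo G r := (finite_nonCoprimeTo hG hr).coe_toFinset
  obtain ⟨Q₀, hQ₀⟩ := N.exists_nat_subset_range
  filter_upwards [eventually_ge_atTop Q₀] with Q hQ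
  have hsub : N ⊆ Finset.range Q := hQ₀.trans (Finset.range_subset_range.2 hQ)
  rw [fFactor_eq hG hr hNc, partialDensity, partialDensity, ← Finset.prod_sdiff hsub,
    ← Finset.prod_sdiff hsub, mul_assoc, ← Finset.prod_mul_distrib]
  congr 1
  · refine Finset.prod_congr rfl fun g hg => localFactor_eq_of_notMem hr fun h => ?_
    rw [← hNc] at h
    exact (Finset.mem_sdiff.1 hg).2 (Finset.mem_coe.1 h)
  · refine Finset.prod_congr rfl fun g _ => ?_
    rw [mul_inv_cancel_left₀ (localFactor_one_pos hH g).ne']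

end ArithmeticFactor

/-! ### Convergence of the products and of the series -/

section Convergence

variable {G : Set ℕ} {H : Finset ℤ}

open Classical in
/-- `1 / n` for `n ∈ G` and `0` for other `n`. -/
noncomputable def recipInd (G : Set ℕ) (n : ℕ) : ℝ := if n ∈ G then 1 / (n : ℝ) else 0

lemma recipInd_nonneg (G : Set ℕ) (n : ℕ) : 0 ≤ recipInd G n := by
  unfold recipInd
  split_ifs <;> positivity

lemma subset_distinctProducts : G ⊆ distinctProducts G := fun g hg =>
  ⟨{g}, by simpa using hg, by simp⟩

open Classical in
-- Each element of `G` is itself a product. Condition A is used with `x = y = n`, where `x ^ ε ≤ y`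
-- and `n ≤ n ^ A`; the logarithm is at least `1` and is dropped.
lemma ConditionA.card_isBigO {θ A ε : ℝ} (hA : 1 ≤ A) (hε1 : ε < 1)
    (hA₁ : ConditionA θ A ε (truncProducts G A)) :
    (fun n : ℕ => ∑ k ∈ Finset.Icc 1 n, if k ∈ G then (1 : ℝ) else 0)
      =O[atTop] fun n : ℕ => (n : ℝ) ^ θ := by
  obtain ⟨C, hC⟩ := hA₁.2
  refine Asymptotics.IsBigO.of_bound |C| ?_
  have hlog : ∀ᶠ n : ℕ in atTop, 1 ≤ Real.log n :=
    (Real.tendsto_log_atTop.comp tendsto_natCast_atTop_atTop).eventually_ge_atTop 1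
  filter_upwards [tendsto_natCast_atTop_atTop.eventually hC, hlog, eventually_ge_atTop 1]
    with n hn hlogn hn1
  have hn1' : (1 : ℝ) ≤ n := by exact_mod_cast hn1
  have h1 := hn n ((Real.rpow_le_rpow_of_exponent_le hn1' hε1.le).trans_eq (Real.rpow_one _))
  rw [← Finset.sum_filter, Finset.sum_const, nsmul_eq_mul, mul_one,
    Real.norm_of_nonneg (Nat.cast_nonneg _), Real.norm_of_nonneg (by positivity)]
  have h2 : ((Finset.Icc 1 n).filter (· ∈ G)).card
      ≤ ({a | a ∈ truncProducts G A n ∧ 1 ≤ a ∧ (a : ℝ) ≤ n} : Set ℕ).ncard := by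
    rw [← Set.ncard_coe_finset]
    refine Set.ncard_le_ncard ?_ ?_
    · intro g hg
      obtain ⟨hg1, hgG⟩ := Finset.mem_filter.1 (Finset.mem_coe.1 hg)
      rw [Finset.mem_Icc] at hg1
      have hgn : (g : ℝ) ≤ n := by exact_mod_cast hg1.2
      refine ⟨⟨subset_distinctProducts hgG, hgn.trans ?_⟩, hg1.1, hgn⟩
      exact (Real.rpow_one _).symm.trans_le (Real.rpow_le_rpow_of_exponent_le hn1' hA)
    · refine (Set.finite_Iic n).subset fun a ha => ?_
      exact_mod_cast ha.2.2
  refine (Nat.cast_le.2 h2).trans (h1.trans ?_)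
  have h3 : (n : ℝ) ^ θ / Real.log n ^ A ≤ (n : ℝ) ^ θ :=
    div_le_self (by positivity) (Real.one_le_rpow hlogn (by linarith))
  have h4 : 0 ≤ (n : ℝ) ^ θ / Real.log n ^ A := by positivity
  exact (mul_le_mul_of_nonneg_right (le_abs_self C) h4).trans
    (mul_le_mul_of_nonneg_left h3 (abs_nonneg C))

/-- Condition A implies that the sum of the reciprocals of the elements of `G` converges. -/
theorem ConditionA.summable_recipInd {θ A ε : ℝ} (hA : 1 ≤ A) (hε1 : ε < 1) (hθ0 : 0 < θ)
    (hθ1 : θ < 1) (hA₁ : ConditionA θ A ε (truncProducts G A)) : Summable (recipInd G) := by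
  classical
  -- Partial summation: the Dirichlet series of the indicator of `G` converges at `s = 1 > θ`.
  have h := LSeriesSummable_of_sum_norm_bigO_and_nonneg (s := 1)
    (hA₁.card_isBigO hA hε1) (fun n => by split_ifs <;> norm_num) hθ0.le (by simpa using hθ1)
  refine h.norm.congr fun n => ?_
  rw [LSeries.term_def]
  by_cases hn : n = 0
  · simp [hn, recipInd]
  · rw [if_neg hn, recipInd]
    split_ifs <;> simp

lemma abs_localFactor_sub_one_le (g : ℕ) :
    ‖localFactor G H 1 g - 1‖ ≤ H.card * recipInd G g := by
  by_cases hg : g ∈ G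
  · rw [localFactor_one_of_mem hg, recipInd, if_pos hg, sub_sub_cancel_left, norm_neg,
      Real.norm_of_nonneg (by positivity), mul_one_div]
    gcongr
    exact Finset.card_image_le
  · simp [localFactor, recipInd, hg]

lemma summable_localFactor_sub_one (hS : Summable (recipInd G)) :
    Summable fun g => localFactor G H 1 g - 1 :=
  Summable.of_norm_bounded (hS.mul_left _) abs_localFactor_sub_one_le

lemma multipliable_localFactor (hS : Summable (recipInd G)) :
    Multipliable (localFactor G H 1) := by
  have := Real.multipliable_one_add_of_summable (summable_localFactor_sub_one (H := H) hS)
  simpa using this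

lemma multipliable_sieveConst (hS : Summable (recipInd G)) :
    Multipliable (fun g : G => 1 - (nu H g : ℝ) / ((g : ℕ) : ℝ)) := by
  have := Real.multipliable_one_add_of_summable
    ((summable_localFactor_sub_one (H := H) hS).comp_injective
      (Subtype.val_injective (p := (· ∈ G))))
  refine this.congr fun g => ?_
  simp only [Function.comp_apply, localFactor_one_of_mem g.2]
  ring

lemma sieveConst_eq_tprod : sieveConst G H = ∏' g, localFactor G H 1 g := by
  have h : Set.mulIndicator G (localFactor G H 1) = localFactor G H 1 := by
    rw [Set.mulIndicator_eq_self]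
    intro g hg
    by_contra hgG
    exact hg (by simp [localFactor, hgG])
  rw [← h, ← tprod_subtype, sieveConst]
  exact tprod_congr fun g => (localFactor_one_of_mem g.2).symm

/-- Admissibility makes every factor positive, and the logarithms are summable. Positivity permits
division by `c_i` in bounding `f_i`. -/
lemma sieveConst_pos (hH : Admissible G H) (hS : Summable (recipInd G)) : 0 < sieveConst G H := by
  have hlog : Summable fun g => Real.log (localFactor G H 1 g) := by
    simpa using Real.summable_log_one_add_of_summable (summable_localFactor_sub_one (H := H) hS)
  rw [sieveConst_eq_tprod, ← Real.rexp_tsum_eq_tprod (localFactor_one_pos hH) hlog]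
  exact Real.exp_pos _

lemma tendsto_partialDensity (hG : G.Pairwise Nat.Coprime) (hH : Admissible G H)
    (hS : Summable (recipInd G)) {r : ℕ} (hr : r ≠ 0) :
    Tendsto (fun Q => partialDensity G H Q r) atTop (𝓝 (sieveConst G H * fFactor G H r)) := by
  have h1 : Tendsto (fun Q => partialDensity G H Q 1) atTop (𝓝 (sieveConst G H)) := by
    rw [sieveConst_eq_tprod]
    exact (multipliable_localFactor hS).hasProd.tendsto_prod_nat
  refine (h1.mul_const (fFactor G H r)).congr' ?_
  filter_upwards [partialDensity_eq hG hH hr] with Q hQ using hQ.symm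

lemma abs_sieveConst_mul_fFactor_le (hG : G.Pairwise Nat.Coprime) (hH : Admissible G H)
    (hS : Summable (recipInd G)) {r : ℕ} (hr : r ≠ 0) :
    |sieveConst G H * fFactor G H r| ≤ 1 := by
  have h := tendsto_partialDensity hG hH hS hr
  have h0 := ge_of_tendsto' h fun Q => partialDensity_nonneg hH Q r
  have h1 := le_of_tendsto' h fun Q => partialDensity_le_one hH Q r
  rwa [abs_of_nonneg h0]

lemma abs_moebius_cast_le_one (r : ℕ) : |(ArithmeticFunction.moebius r : ℝ)| ≤ 1 := by
  exact_mod_cast ArithmeticFunction.abs_moebius_le_one (n := r)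

variable {G₁ G₂ : Set ℕ} {H₁ H₂ : Finset ℤ}

/-- After multiplication by `c₁c₂` the term is `μ(r) / r ^ 2` times two numbers of absolute value at
most `1`. -/
theorem summable_visTerm (hG₁ : G₁.Pairwise Nat.Coprime) (hG₂ : G₂.Pairwise Nat.Coprime)
    (hH₁ : Admissible G₁ H₁) (hH₂ : Admissible G₂ H₂) (hS₁ : Summable (recipInd G₁))
    (hS₂ : Summable (recipInd G₂)) : Summable (visTerm G₁ G₂ H₁ H₂) := by
  have hc₁ := sieveConst_pos hH₁ hS₁
  have hc₂ := sieveConst_pos hH₂ hS₂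
  have hs : Summable fun r : ℕ => (1 / (r : ℝ) ^ 2) * (1 / (sieveConst G₁ H₁ * sieveConst G₂ H₂)) :=
    (Real.summable_one_div_nat_pow.2 (by norm_num)).mul_right _
  refine Summable.of_norm_bounded hs fun r => ?_
  rcases eq_or_ne r 0 with rfl | hr
  · simp [visTerm]
  have h1 := abs_sieveConst_mul_fFactor_le hG₁ hH₁ hS₁ hr
  have h2 := abs_sieveConst_mul_fFactor_le hG₂ hH₂ hS₂ hr
  have e : visTerm G₁ G₂ H₁ H₂ r = ((ArithmeticFunction.moebius r : ℝ)
      * (sieveConst G₁ H₁ * fFactor G₁ H₁ r) * (sieveConst G₂ H₂ * fFactor G₂ H₂ r))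
      * ((1 / (r : ℝ) ^ 2) * (1 / (sieveConst G₁ H₁ * sieveConst G₂ H₂))) := by
    rw [visTerm]
    field_simp
  rw [e, norm_mul, Real.norm_of_nonneg (by positivity : (0 : ℝ) ≤
    (1 / (r : ℝ) ^ 2) * (1 / (sieveConst G₁ H₁ * sieveConst G₂ H₂)))]
  refine mul_le_of_le_one_left (by positivity) ?_
  rw [Real.norm_eq_abs, abs_mul, abs_mul]
  exact mul_le_one₀ (mul_le_one₀ (abs_moebius_cast_le_one r) (abs_nonneg _) h1) (abs_nonneg _) h2

/-- The densities of the sets sieved by the moduli below `Q` and the primes below `Q` converge. -/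
theorem tendsto_sum_partialDensity (hG₁ : G₁.Pairwise Nat.Coprime)
    (hG₂ : G₂.Pairwise Nat.Coprime) (hH₁ : Admissible G₁ H₁) (hH₂ : Admissible G₂ H₂)
    (hS₁ : Summable (recipInd G₁)) (hS₂ : Summable (recipInd G₂)) {W : ℕ → ℕ}
    (hW0 : ∀ Q, W Q ≠ 0) (hW : ∀ r, Squarefree r → ∀ᶠ Q in atTop, r ∣ W Q) :
    Tendsto (fun Q => ∑ r ∈ (W Q).divisors, (ArithmeticFunction.moebius r : ℝ)
      * ((1 / r * partialDensity G₁ H₁ Q r) * (1 / r * partialDensity G₂ H₂ Q r))) atTop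
      (𝓝 (sieveConst G₁ H₁ * sieveConst G₂ H₂ * visConst G₁ G₂ H₁ H₂)) := by
  classical
  let F : ℕ → ℕ → ℝ := fun Q r => if r ∈ (W Q).divisors then (ArithmeticFunction.moebius r : ℝ)
      * ((1 / r * partialDensity G₁ H₁ Q r) * (1 / r * partialDensity G₂ H₂ Q r)) else 0
  have hF : ∀ Q, ∑ r ∈ (W Q).divisors, (ArithmeticFunction.moebius r : ℝ)
      * ((1 / r * partialDensity G₁ H₁ Q r) * (1 / r * partialDensity G₂ H₂ Q r))
      = ∑' r, F Q r := fun Q => by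
    rw [tsum_eq_sum (s := (W Q).divisors) fun r hr => if_neg hr]
    exact Finset.sum_congr rfl fun r hr => (if_pos hr).symm
  simp_rw [hF]
  rw [visConst, ← tsum_mul_left]
  -- The partial densities lie in `[0, 1]`, so `1 / r ^ 2` dominates for every `Q`.
  refine tendsto_tsum_of_dominated_convergence (bound := fun r : ℕ => 1 / (r : ℝ) ^ 2)
    (Real.summable_one_div_nat_pow.2 (by norm_num)) (fun r => ?_) (Eventually.of_forall
      fun Q r => ?_)
  · by_cases hr : Squarefree r
    · have h1 := tendsto_partialDensity hG₁ hH₁ hS₁ hr.ne_zero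
      have h2 := tendsto_partialDensity hG₂ hH₂ hS₂ hr.ne_zero
      have h3 := ((h1.const_mul (1 / (r : ℝ))).mul (h2.const_mul (1 / (r : ℝ)))).const_mul
        (ArithmeticFunction.moebius r : ℝ)
      have e : (ArithmeticFunction.moebius r : ℝ)
          * (1 / r * (sieveConst G₁ H₁ * fFactor G₁ H₁ r)
            * (1 / r * (sieveConst G₂ H₂ * fFactor G₂ H₂ r)))
          = sieveConst G₁ H₁ * sieveConst G₂ H₂ * visTerm G₁ G₂ H₁ H₂ r := by
        rw [visTerm]
        ring
      rw [e] at h3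
      refine h3.congr' ?_
      filter_upwards [hW r hr] with Q hQ
      exact (if_pos (Nat.mem_divisors.2 ⟨hQ, hW0 Q⟩)).symm
    · have e : visTerm G₁ G₂ H₁ H₂ r = 0 := by
        simp [visTerm, ArithmeticFunction.moebius_eq_zero_of_not_squarefree hr]
      rw [e, mul_zero]
      refine tendsto_const_nhds.congr fun Q => ?_
      simp [F, ArithmeticFunction.moebius_eq_zero_of_not_squarefree hr]
  · by_cases hr : r ∈ (W Q).divisors
    · simp only [F, if_pos hr]
      have e : (ArithmeticFunction.moebius r : ℝ)
          * (1 / r * partialDensity G₁ H₁ Q r * (1 / r * partialDensity G₂ H₂ Q r))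
          = ((ArithmeticFunction.moebius r : ℝ) * partialDensity G₁ H₁ Q r
            * partialDensity G₂ H₂ Q r) * (1 / (r : ℝ) ^ 2) := by ring
      rw [e, norm_mul, Real.norm_of_nonneg (by positivity : (0 : ℝ) ≤ 1 / (r : ℝ) ^ 2)]
      refine mul_le_of_le_one_left (by positivity) ?_
      rw [Real.norm_eq_abs, abs_mul, abs_mul, abs_of_nonneg (partialDensity_nonneg hH₁ Q r),
        abs_of_nonneg (partialDensity_nonneg hH₂ Q r)]
      exact mul_le_one₀ (mul_le_one₀ (abs_moebius_cast_le_one r) (partialDensity_nonneg hH₁ Q r)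
        (partialDensity_le_one hH₁ Q r)) (partialDensity_nonneg hH₂ Q r)
        (partialDensity_le_one hH₂ Q r)
    · simp only [F, if_neg hr, norm_zero]
      positivity

end Convergence

/-! ### Truncated conditions and their error terms -/

section Truncation

/-- The product of the primes below `Q`. -/
def primesBelowProd (Q : ℕ) : ℕ := ∏ p ∈ (Finset.range Q).filter Nat.Prime, p

lemma primesBelowProd_ne_zero (Q : ℕ) : primesBelowProd Q ≠ 0 :=
  Finset.prod_ne_zero_iff.2 fun _ hp => (Finset.mem_filter.1 hp).2.ne_zero

lemma dvd_primesBelowProd {p Q : ℕ} (hp : p.Prime) (hQ : p < Q) : p ∣ primesBelowProd Q :=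
  Finset.dvd_prod_of_mem _ (Finset.mem_filter.2 ⟨Finset.mem_range.2 hQ, hp⟩)

lemma eventually_dvd_primesBelowProd {r : ℕ} (hr : Squarefree r) :
    ∀ᶠ Q in atTop, r ∣ primesBelowProd Q := by
  filter_upwards [eventually_gt_atTop r] with Q hQ
  rw [← Nat.prod_primeFactors_of_squarefree hr]
  refine Finset.prod_dvd_prod_of_subset _ _ _ fun p hp => ?_
  exact Finset.mem_filter.2 ⟨Finset.mem_range.2 ((Nat.le_of_mem_primeFactors hp).trans_lt hQ),
    Nat.prime_of_mem_primeFactors hp⟩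

open Classical in
/-- The elements of `G` below `Q`. -/
noncomputable def below (G : Set ℕ) (Q : ℕ) : Finset ℕ := (Finset.range Q).filter (· ∈ G)

lemma mem_below {G : Set ℕ} {Q g : ℕ} : g ∈ below G Q ↔ g < Q ∧ g ∈ G := by
  simp [below]

lemma prod_below_eq (G : Set ℕ) (H : Finset ℤ) (Q r : ℕ) :
    ∏ g ∈ below G Q, (1 - (g.gcd r : ℝ) * kappa H g (g.gcd r) / g) = partialDensity G H Q r := by
  rw [below, Finset.prod_filter]
  rfl

/-- The indicator function of the points that satisfy the congruence conditions for the moduli and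
the primes below `Q`, as a sum over divisors. -/
noncomputable def truncInd (G₁ G₂ : Set ℕ) (H₁ H₂ : Finset ℤ) (Q m n : ℕ) : ℝ :=
  ∑ r ∈ (primesBelowProd Q).divisors, (ArithmeticFunction.moebius r : ℝ)
    * (siftInd H₁ (below G₁ Q) r m * siftInd H₂ (below G₂ Q) r n)

lemma siftInd_eq_mul (H : Finset ℤ) (T : Finset ℕ) (r m : ℕ) :
    siftInd H T r m = (if r ∣ m then 1 else 0) * siftInd H T 1 m := by
  simp only [siftInd, ite_zero_mul_ite_zero, one_dvd, true_and, mul_one]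

lemma siftInd_one_nonneg (H : Finset ℤ) (T : Finset ℕ) (m : ℕ) : 0 ≤ siftInd H T 1 m := by
  unfold siftInd; split_ifs <;> norm_num

lemma siftInd_one_le_one (H : Finset ℤ) (T : Finset ℕ) (m : ℕ) : siftInd H T 1 m ≤ 1 := by
  unfold siftInd; split_ifs <;> norm_num

lemma sum_moebius_divisors {k : ℕ} :
    ∑ d ∈ k.divisors, (ArithmeticFunction.moebius d : ℝ) = if k = 1 then 1 else 0 := by
  have h := congrArg (fun f : ArithmeticFunction ℤ => f k)
    ArithmeticFunction.coe_zeta_mul_moebius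
  simp only [ArithmeticFunction.coe_zeta_mul_apply, ArithmeticFunction.one_apply] at h
  have h2 := congrArg (fun z : ℤ => (z : ℝ)) h
  push_cast at h2
  exact h2

/-- Möbius inversion over the divisors of `gcd(m, n, W)`, where `W` is the product of the primes
below `Q`. -/
lemma truncInd_eq (G₁ G₂ : Set ℕ) (H₁ H₂ : Finset ℤ) (Q m n : ℕ) :
    truncInd G₁ G₂ H₁ H₂ Q m n
      = (if (m.gcd n).Coprime (primesBelowProd Q) then 1 else 0)
        * (siftInd H₁ (below G₁ Q) 1 m * siftInd H₂ (below G₂ Q) 1 n) := by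
  have hW := primesBelowProd_ne_zero Q
  have e : (if (m.gcd n).Coprime (primesBelowProd Q) then (1 : ℝ) else 0)
      = ∑ r ∈ (primesBelowProd Q).divisors, (ArithmeticFunction.moebius r : ℝ)
        * ((if r ∣ m then 1 else 0) * (if r ∣ n then 1 else 0)) := by
    rw [if_congr Nat.coprime_iff_gcd_eq_one.symm rfl rfl, ← sum_moebius_divisors]
    simp_rw [ite_zero_mul_ite_zero]
    simp only [mul_one, mul_ite, mul_zero]
    rw [← Finset.sum_filter]
    refine Finset.sum_congr ?_ fun _ _ => rfl
    ext d
    simp only [Nat.mem_divisors, Finset.mem_filter, Nat.dvd_gcd_iff, ne_eq, Nat.gcd_eq_zero_iff, hW,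
      and_false, not_false_eq_true, and_true]
    tauto
  rw [truncInd, e, Finset.sum_mul]
  refine Finset.sum_congr rfl fun r _ => ?_
  rw [siftInd_eq_mul H₁, siftInd_eq_mul H₂]
  ring

open Classical in
/-- The indicator function of the numbers congruent to an element of `H` modulo an element of `G`
that is at least `Q`. -/
noncomputable def tailInd (G : Set ℕ) (H : Finset ℤ) (Q m : ℕ) : ℝ :=
  if ∃ g ∈ G, Q ≤ g ∧ ∃ h ∈ H, (m : ℤ) ≡ h [ZMOD (g : ℤ)] then 1 else 0

lemma tailInd_nonneg (G : Set ℕ) (H : Finset ℤ) (Q m : ℕ) : 0 ≤ tailInd G H Q m := by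
  unfold tailInd; split_ifs <;> norm_num

lemma tailInd_le_one (G : Set ℕ) (H : Finset ℤ) (Q m : ℕ) : tailInd G H Q m ≤ 1 := by
  unfold tailInd; split_ifs <;> norm_num

/-- The indicator function of `sievedVisible`. -/
noncomputable def visInd (G₁ G₂ : Set ℕ) (H₁ H₂ : Finset ℤ) (p : ℕ × ℕ) : ℝ :=
  (sievedVisible G₁ G₂ H₁ H₂).indicator (fun _ => (1 : ℝ)) p

lemma visInd_nonneg (G₁ G₂ : Set ℕ) (H₁ H₂ : Finset ℤ) (p : ℕ × ℕ) :
    0 ≤ visInd G₁ G₂ H₁ H₂ p :=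
  Set.indicator_nonneg (fun _ _ => zero_le_one) p

lemma visInd_le_one (G₁ G₂ : Set ℕ) (H₁ H₂ : Finset ℤ) (p : ℕ × ℕ) :
    visInd G₁ G₂ H₁ H₂ p ≤ 1 :=
  Set.indicator_le' (fun _ _ => le_rfl) (fun _ _ => zero_le_one) p

lemma siftInd_one_eq_one {G : Set ℕ} {H : Finset ℤ} {m : ℕ} (hm : m ∈ sieved G H) (Q : ℕ) :
    siftInd H (below G Q) 1 m = 1 :=
  if_pos ⟨one_dvd _, fun g hg h hh => hm h hh g (mem_below.1 hg).2⟩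

lemma siftInd_one_le {G : Set ℕ} {H : Finset ℤ} {m : ℕ} (hm : m ∉ sieved G H) (Q : ℕ) :
    siftInd H (below G Q) 1 m ≤ tailInd G H Q m := by
  by_cases ht : ∃ g ∈ G, Q ≤ g ∧ ∃ h ∈ H, (m : ℤ) ≡ h [ZMOD (g : ℤ)]
  · rw [tailInd, if_pos ht]
    exact siftInd_one_le_one _ _ _
  · rw [tailInd, if_neg ht, siftInd, if_neg]
    rintro ⟨_, h1⟩
    refine hm fun h hh g hg hc => ?_
    by_cases hQ : Q ≤ g
    · exact ht ⟨g, hg, hQ, h, hh, hc⟩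
    · exact h1 g (mem_below.2 ⟨not_le.1 hQ, hg⟩) h hh hc

lemma visInd_le_truncInd (G₁ G₂ : Set ℕ) (H₁ H₂ : Finset ℤ) (Q m n : ℕ) :
    visInd G₁ G₂ H₁ H₂ (m, n) ≤ truncInd G₁ G₂ H₁ H₂ Q m n := by
  rw [truncInd_eq]
  by_cases h : (m, n) ∈ sievedVisible G₁ G₂ H₁ H₂
  · have h3 : (m.gcd n).Coprime (primesBelowProd Q) := by
      rw [show m.gcd n = 1 from h.2.2]
      exact Nat.coprime_one_left _
    rw [siftInd_one_eq_one h.1, siftInd_one_eq_one h.2.1, if_pos h3, mul_one, mul_one]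
    exact visInd_le_one _ _ _ _ _
  · rw [visInd, Set.indicator_of_notMem h]
    exact mul_nonneg (by split_ifs <;> norm_num)
      (mul_nonneg (siftInd_one_nonneg _ _ _) (siftInd_one_nonneg _ _ _))

/-- A point that passes the truncated test but not the full one violates a condition with `g ≥ Q`,
or has a common prime `p ≥ Q` of `m` and `n`. Such a `p` divides `m + n = j`, which is how
`commonInd` enters. -/
lemma truncInd_le (G₁ G₂ : Set ℕ) (H₁ H₂ : Finset ℤ) (Q : ℕ) {m n j : ℕ} (hj : m + n = j) :
    truncInd G₁ G₂ H₁ H₂ Q m n ≤ visInd G₁ G₂ H₁ H₂ (m, n)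
      + (tailInd G₁ H₁ Q m + tailInd G₂ H₂ Q n + commonInd Q j m + if j = 0 then 1 else 0) := by
  have a1 := tailInd_nonneg G₁ H₁ Q m
  have a2 := tailInd_nonneg G₂ H₂ Q n
  have a3 := commonInd_nonneg Q j m
  have a4 : (0 : ℝ) ≤ if j = 0 then 1 else 0 := by split_ifs <;> norm_num
  have a5 := visInd_nonneg G₁ G₂ H₁ H₂ (m, n)
  have b1 := siftInd_one_nonneg H₁ (below G₁ Q) m
  have b2 := siftInd_one_nonneg H₂ (below G₂ Q) n
  have c1 := siftInd_one_le_one H₁ (below G₁ Q) m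
  have c2 := siftInd_one_le_one H₂ (below G₂ Q) n
  rw [truncInd_eq]
  have d0 : (if (m.gcd n).Coprime (primesBelowProd Q) then (1 : ℝ) else 0) ≤ 1 := by
    split_ifs <;> norm_num
  have d1 : (0 : ℝ) ≤ if (m.gcd n).Coprime (primesBelowProd Q) then (1 : ℝ) else 0 := by
    split_ifs <;> norm_num
  by_cases hm : m ∈ sieved G₁ H₁
  · by_cases hn : n ∈ sieved G₂ H₂
    · by_cases hc : m.Coprime n
      · have hmem : (m, n) ∈ sievedVisible G₁ G₂ H₁ H₂ := ⟨hm, hn, hc⟩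
        have : visInd G₁ G₂ H₁ H₂ (m, n) = 1 := Set.indicator_of_mem hmem _
        rw [this]
        have := mul_le_one₀ d0 (mul_nonneg b1 b2) (mul_le_one₀ c1 b2 c2)
        linarith
      · rcases eq_or_ne j 0 with h0 | h0
        -- At `j = 0` the set of prime factors is empty by convention, so the origin is charged to a
        -- separate term.
        · rw [if_pos h0] at a4 ⊢
          have := mul_le_one₀ d0 (mul_nonneg b1 b2) (mul_le_one₀ c1 b2 c2)
          linarith
        · obtain ⟨p, hp, hpd⟩ := Nat.exists_prime_and_dvd hc
          have hpm := hpd.trans (Nat.gcd_dvd_left m n)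
          have hpn := hpd.trans (Nat.gcd_dvd_right m n)
          by_cases hpQ : Q ≤ p
          · have : commonInd Q j m = 1 := if_pos ⟨p, Nat.mem_primeFactors.2
              ⟨hp, hj ▸ dvd_add hpm hpn, h0⟩, hpQ, hpm⟩
            rw [this]
            have := mul_le_one₀ d0 (mul_nonneg b1 b2) (mul_le_one₀ c1 b2 c2)
            linarith
          · rw [if_neg, zero_mul]
            · linarith
            · exact Nat.not_coprime_of_dvd_of_dvd hp.one_lt hpd
                (dvd_primesBelowProd hp (not_le.1 hpQ))
    · have h1 := siftInd_one_le hn Q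
      have h2 := mul_le_of_le_one_left (mul_nonneg b1 b2) d0
      have h3 := mul_le_of_le_one_left b2 c1
      linarith
  · have h1 := siftInd_one_le hm Q
    have h2 := mul_le_of_le_one_left (mul_nonneg b1 b2) d0
    have h3 := mul_le_of_le_one_right b1 c2
    linarith

/-- The tail of the sum of the reciprocals of the elements of `G`. -/
noncomputable def recipTail (G : Set ℕ) (Q : ℕ) : ℝ := ∑' k : ℕ, recipInd G (k + Q)

lemma tendsto_recipTail (G : Set ℕ) : Tendsto (recipTail G) atTop (𝓝 0) :=
  tendsto_sum_nat_add (recipInd G)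

lemma recipTail_nonneg (G : Set ℕ) (Q : ℕ) : 0 ≤ recipTail G Q :=
  tsum_nonneg fun _ => recipInd_nonneg _ _

lemma sum_Ico_recipInd_le {G : Set ℕ} (hS : Summable (recipInd G)) (Q M : ℕ) :
    ∑ g ∈ Finset.Ico Q M, recipInd G g ≤ recipTail G Q := by
  rw [Finset.sum_Ico_eq_sum_range]
  simp_rw [add_comm Q]
  exact ((summable_nat_add_iff Q).2 hS).sum_le_tsum _ fun _ _ => recipInd_nonneg _ _

open Classical in
lemma card_modEq_le {g : ℕ} (hg : 0 < g) (h : ℤ) (n : ℕ) :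
    (((Finset.range n).filter fun m : ℕ => (m : ℤ) ≡ h [ZMOD (g : ℤ)]).card : ℝ)
      ≤ (n : ℝ) / g + 1 := by
  have hg' : (g : ℤ) ≠ 0 := by exact_mod_cast hg.ne'
  obtain ⟨v, hv⟩ := Int.eq_ofNat_of_zero_le (Int.emod_nonneg h hg')
  have e : ∀ m : ℕ, (m : ℤ) ≡ h [ZMOD (g : ℤ)] ↔ m ≡ v [MOD g] := fun m => by
    rw [← Int.natCast_modEq_iff]
    have : h ≡ (v : ℤ) [ZMOD (g : ℤ)] := by
      have := (Int.mod_modEq h g).symm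
      rwa [hv] at this
    exact ⟨fun a => a.trans this, fun a => a.trans this.symm⟩
  have h1 := Nat.count_modEq_card n hg v
  rw [Nat.count_eq_card_filter_range] at h1
  simp_rw [e]
  have h2 : ((Finset.range n).filter fun m : ℕ => m ≡ v [MOD g]).card ≤ n / g + 1 := by
    rw [show ((Finset.range n).filter fun m : ℕ => m ≡ v [MOD g]).card = _ by convert h1]
    gcongr
    split_ifs <;> norm_num
  calc (((Finset.range n).filter fun m : ℕ => m ≡ v [MOD g]).card : ℝ)
      ≤ ((n / g + 1 : ℕ) : ℝ) := by exact_mod_cast h2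
    _ ≤ (n : ℝ) / g + 1 := by
        push_cast
        gcongr
        exact Nat.cast_div_le

/-- The integer `m = h` satisfies the congruence for every `g`, and is counted once per `h`.
Otherwise `g` divides the nonzero `h - m`, so `g < n + K`, and the count `n / g + 1` is at most `(2n
+ K) / g`. -/
lemma sum_tailInd_le {G : Set ℕ} {H : Finset ℤ} (hH : Admissible G H)
    (hS : Summable (recipInd G)) {K : ℕ} (hK : ∀ h ∈ H, h.natAbs < K) (Q n : ℕ) :
    ∑ m ∈ Finset.range n, tailInd G H Q m
      ≤ H.card * (1 + (2 * n + K) * recipTail G Q) := by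
  classical
  have h1 : ∀ m ∈ Finset.range n, tailInd G H Q m
      ≤ ∑ h ∈ H, ((if (m : ℤ) = h then 1 else 0)
        + ∑ g ∈ (Finset.Ico Q (n + K)).filter (· ∈ G),
          if (m : ℤ) ≡ h [ZMOD (g : ℤ)] then (1 : ℝ) else 0) := by
    intro m hm
    have hin : ∀ h : ℤ, (0 : ℝ) ≤ ∑ g ∈ (Finset.Ico Q (n + K)).filter (· ∈ G),
        if (m : ℤ) ≡ h [ZMOD (g : ℤ)] then (1 : ℝ) else 0 := fun h =>
      Finset.sum_nonneg fun g _ => by split_ifs <;> norm_num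
    have hi2 : ∀ h : ℤ, (0 : ℝ) ≤ if (m : ℤ) = h then 1 else 0 := fun h => by
      split_ifs <;> norm_num
    rw [tailInd]
    split_ifs with ht
    · obtain ⟨g, hg, hQ, h, hh, hc⟩ := ht
      refine le_trans ?_ (Finset.single_le_sum (fun h _ => add_nonneg (hi2 h) (hin h)) hh)
      by_cases hmh : (m : ℤ) = h
      · rw [if_pos hmh]
        linarith [hin h]
      · have hgm : g < n + K := by
          have hd := Int.modEq_iff_dvd.1 hc
          have hne : h - m ≠ 0 := fun h0 => hmh (by omega)
          have hle := Int.natAbs_le_of_dvd_ne_zero hd hne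
          have := hK h hh
          rw [Finset.mem_range] at hm
          omega
        refine le_trans ?_ (le_add_of_nonneg_left (hi2 h))
        refine le_trans ?_ (Finset.single_le_sum (f := fun g : ℕ =>
          if (m : ℤ) ≡ h [ZMOD (g : ℤ)] then (1 : ℝ) else 0)
          (fun g _ => by split_ifs <;> norm_num)
          (Finset.mem_filter.2 ⟨Finset.mem_Ico.2 ⟨hQ, hgm⟩, hg⟩))
        simp only [if_pos hc, le_refl]
    · exact Finset.sum_nonneg fun h _ => add_nonneg (hi2 h) (hin h)
  refine (Finset.sum_le_sum h1).trans ?_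
  rw [Finset.sum_comm, ← nsmul_eq_mul]
  refine Finset.sum_le_card_nsmul _ _ _ fun h _ => ?_
  rw [Finset.sum_add_distrib]
  refine add_le_add ?_ ?_
  · rw [← Finset.sum_filter, Finset.sum_const, nsmul_eq_mul, mul_one]
    have : ((Finset.range n).filter fun m : ℕ => (m : ℤ) = h).card ≤ 1 :=
      Finset.card_le_one.2 fun a ha b hb => by
        have e1 := (Finset.mem_filter.1 ha).2
        have e2 := (Finset.mem_filter.1 hb).2
        omega
    exact_mod_cast this
  · rw [Finset.sum_comm]
    have h2 : ∀ g ∈ (Finset.Ico Q (n + K)).filter (· ∈ G),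
        (∑ m ∈ Finset.range n, if (m : ℤ) ≡ h [ZMOD (g : ℤ)] then (1 : ℝ) else 0)
          ≤ (2 * n + K) * recipInd G g := by
      intro g hg
      obtain ⟨hg1, hgG⟩ := Finset.mem_filter.1 hg
      have hg0 := hH.pos hgG
      have hg0' : (0 : ℝ) < g := by exact_mod_cast hg0
      have hgle : (g : ℝ) ≤ n + K := by exact_mod_cast (Finset.mem_Ico.1 hg1).2.le
      rw [← Finset.sum_filter, Finset.sum_const, nsmul_eq_mul, mul_one, recipInd, if_pos hgG,
        mul_one_div]
      refine (card_modEq_le hg0 h n).trans ?_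
      rw [le_div_iff₀ hg0', add_mul, div_mul_cancel₀ _ hg0'.ne']
      linarith
    refine (Finset.sum_le_sum h2).trans ?_
    rw [← Finset.mul_sum]
    refine mul_le_mul_of_nonneg_left ?_ (by positivity)
    exact (Finset.sum_le_sum_of_subset_of_nonneg (Finset.filter_subset _ _)
      fun g _ _ => recipInd_nonneg _ _).trans (sum_Ico_recipInd_le hS Q (n + K))

lemma avg_tailInd_le {G : Set ℕ} {H : Finset ℤ} (hH : Admissible G H)
    (hS : Summable (recipInd G)) (Q : ℕ) : ∃ u : ℕ → ℝ, Tendsto u atTop (𝓝 0) ∧ ∀ n : ℕ,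
      (∑ m ∈ Finset.range n, tailInd G H Q m) / (n : ℝ) ≤ 2 * H.card * recipTail G Q + u n := by
  obtain ⟨K, hK⟩ : ∃ K : ℕ, ∀ h ∈ H, h.natAbs < K :=
    ⟨(H.sup Int.natAbs) + 1, fun h hh => Nat.lt_succ_of_le (Finset.le_sup hh)⟩
  refine ⟨fun n => H.card * (1 + K * recipTail G Q) / (n : ℝ),
    tendsto_const_div_atTop_nhds_zero_nat _, fun n => ?_⟩
  have h0 := recipTail_nonneg G Q
  rcases Nat.eq_zero_or_pos n with rfl | hn
  · simp only [Nat.cast_zero, div_zero, add_zero]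
    positivity
  · have hn' : (0 : ℝ) < n := by exact_mod_cast hn
    rw [div_le_iff₀ hn', add_mul, div_mul_cancel₀ _ hn'.ne']
    refine (sum_tailInd_le hH hS hK Q n).trans_eq ?_
    ring

end Truncation

/-! ### From the truncated problem to the full one -/

section Limit

variable {Ω : Type*} [MeasurableSpace Ω] {μ : Measure Ω} [IsProbabilityMeasure μ]
  {α : ℝ} {η : ℕ → Ω → ℕ}

lemma dvd_add_sub_iff {R c : ℕ} (hc : c < R) (x : ℕ) : R ∣ x + (R - c) ↔ x % R = c := by
  have h := Nat.div_add_mod x R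
  have h2 := Nat.mod_lt x (Nat.zero_lt_of_lt hc)
  constructor
  · intro hd
    have h3 : R ∣ x % R + (R - c) := by
      have : x + (R - c) = R * (x / R) + (x % R + (R - c)) := by omega
      rw [this] at hd
      exact (Nat.dvd_add_right (dvd_mul_right _ _)).1 hd
    obtain ⟨k, hk⟩ := h3
    have hk1 : k = 1 := by
      have hlt : R * k < R * 2 := by omega
      have hpos : 0 < R * k := by omega
      have h4 := Nat.lt_of_mul_lt_mul_left hlt
      have h5 : k ≠ 0 := by
        rintro rfl
        simp at hpos
      omega
    rw [hk1] at hk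
    omega
  · intro hx
    have : x + (R - c) = R * (x / R + 1) := by
      rw [mul_add, mul_one]
      omega
    exact ⟨_, this⟩

lemma eq_sum_classInd {R : ℕ} (hR : 0 < R) {φ : ℕ → ℝ} (hφ : Function.Periodic φ R) (x : ℕ) :
    φ x = ∑ c ∈ Finset.range R, φ c * classInd R (R - c) x := by
  rw [Finset.sum_eq_single_of_mem (x % R) (Finset.mem_range.2 (Nat.mod_lt _ hR))]
  · rw [classInd, if_pos ((dvd_add_sub_iff (Nat.mod_lt _ hR) x).2 rfl), mul_one, hφ.map_mod_nat]
  · intro c hc hne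
    rw [classInd, if_neg fun h =>
      hne ((dvd_add_sub_iff (Finset.mem_range.1 hc) x).1 h).symm, mul_zero]

/-- As `x + y = j`, fixing the classes of both coordinates is the same as fixing those of the time
and the first coordinate. -/
lemma classInd_mul_classInd {x y j : ℕ} (hj : x + y = j) (R u v : ℕ) :
    classInd R u x * classInd R v y = classInd R (u + v) j * classInd R u x := by
  unfold classInd
  by_cases h : R ∣ x + u
  · have e : j + (u + v) = (x + u) + (y + v) := by omega
    simp [h, e, Nat.dvd_add_right h]
  · simp [h]

/-- Products of periodic functions of the coordinates average to the product of the mean values. -/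
theorem IsBernoulliSeq.ae_tendsto_periodic (h : IsBernoulliSeq α η μ) (h0 : 0 < α) (h1 : α < 1)
    {R : ℕ} (hR : 0 < R) {φ ψ : ℕ → ℝ} (hφ : Function.Periodic φ R)
    (hψ : Function.Periodic ψ R) {Y : ℕ → Ω → ℕ} (hY : ∀ j ω, incr η 0 j ω + Y j ω = j) :
    ∀ᵐ ω ∂μ, Tendsto (fun n : ℕ => (∑ j ∈ Finset.range n,
      φ (incr η 0 j ω) * ψ (Y j ω)) / (n : ℝ)) atTop (𝓝 (periodMean R φ * periodMean R ψ)) := by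
  have hall : ∀ᵐ ω ∂μ, ∀ c d : ℕ, Tendsto (fun n : ℕ => (∑ j ∈ Finset.range n,
      classInd R ((R - c) + (R - d)) j * classInd R (R - c) (incr η 0 j ω)) / (n : ℝ)) atTop
      (𝓝 (1 / R * (1 / R))) :=
    ae_all_iff.2 fun c => ae_all_iff.2 fun d => h.ae_tendsto_classInd h0 h1 hR _ _
  filter_upwards [hall] with ω hω
  have hsum := tendsto_finsetSum (Finset.range R) fun c _ => tendsto_finsetSum (Finset.range R)
    fun d _ => (hω c d).const_mul (φ c * ψ d)
  have elim : ∑ c ∈ Finset.range R, ∑ d ∈ Finset.range R, φ c * ψ d * (1 / R * (1 / R))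
      = periodMean R φ * periodMean R ψ := by
    simp only [periodMean, div_mul_div_comm, Finset.sum_mul_sum, Finset.sum_div]
    refine Finset.sum_congr rfl fun c _ => Finset.sum_congr rfl fun d _ => ?_
    ring
  rw [elim] at hsum
  refine hsum.congr fun n => ?_
  have hpt : ∀ j, φ (incr η 0 j ω) * ψ (Y j ω)
      = ∑ c ∈ Finset.range R, ∑ d ∈ Finset.range R, φ c * ψ d
        * (classInd R ((R - c) + (R - d)) j * classInd R (R - c) (incr η 0 j ω)) := fun j => by
    rw [eq_sum_classInd hR hφ, eq_sum_classInd hR hψ, Finset.sum_mul_sum]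
    refine Finset.sum_congr rfl fun c _ => Finset.sum_congr rfl fun d _ => ?_
    rw [← classInd_mul_classInd (hY j ω)]
    ring
  simp_rw [hpt]
  symm
  rw [Finset.sum_comm, Finset.sum_div]
  refine Finset.sum_congr rfl fun c _ => ?_
  rw [Finset.sum_comm, Finset.sum_div]
  refine Finset.sum_congr rfl fun d _ => ?_
  rw [← Finset.mul_sum, mul_div_assoc]

variable {G₁ G₂ : Set ℕ} {H₁ H₂ : Finset ℤ}

theorem IsBernoulliSeq.ae_tendsto_truncInd (h : IsBernoulliSeq α η μ) (h0 : 0 < α) (h1 : α < 1)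
    (hG₁ : G₁.Pairwise Nat.Coprime) (hG₂ : G₂.Pairwise Nat.Coprime) (hH₁ : Admissible G₁ H₁)
    (hH₂ : Admissible G₂ H₂) {Y : ℕ → Ω → ℕ} (hY : ∀ j ω, incr η 0 j ω + Y j ω = j) (Q : ℕ) :
    ∀ᵐ ω ∂μ, Tendsto (fun n : ℕ => (∑ j ∈ Finset.range n,
      truncInd G₁ G₂ H₁ H₂ Q (incr η 0 j ω) (Y j ω)) / (n : ℝ)) atTop
      (𝓝 (∑ r ∈ (primesBelowProd Q).divisors, (ArithmeticFunction.moebius r : ℝ)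
        * ((1 / r * partialDensity G₁ H₁ Q r) * (1 / r * partialDensity G₂ H₂ Q r)))) := by
  -- A common period: the first factor is a multiple of every `r`, the factorial of every `g < Q` in
  -- `G₁` and `G₂`.
  set R := primesBelowProd Q * Q.factorial with hRdef
  have hR : 0 < R := Nat.mul_pos (Nat.pos_of_ne_zero (primesBelowProd_ne_zero Q))
    (Nat.factorial_pos Q)
  have hdvd : ∀ G : Set ℕ, ∀ H, Admissible G H → ∀ g ∈ below G Q, g ∣ R := fun G H hH g hg =>
    (Nat.dvd_factorial (hH.pos (mem_below.1 hg).2) (mem_below.1 hg).1.le).mul_left _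
  have hp : ∀ G : Set ℕ, ∀ H, Admissible G H → ∀ r ∈ (primesBelowProd Q).divisors,
      Function.Periodic (siftInd H (below G Q) r) R := fun G H hH r hr =>
    siftInd_periodic ((Nat.dvd_of_mem_divisors hr).mul_right _) (hdvd G H hH)
  have hmean : ∀ G : Set ℕ, ∀ H, G.Pairwise Nat.Coprime → Admissible G H →
      ∀ r ∈ (primesBelowProd Q).divisors, Squarefree r →
      periodMean R (siftInd H (below G Q) r) = 1 / r * partialDensity G H Q r :=
    fun G H hG hH r hr hsq => by
      rw [mean_siftInd (hG.mono fun g hg => (mem_below.1 (Finset.mem_coe.1 hg)).2)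
        (fun g hg => hH.pos (mem_below.1 hg).2) hsq hR
        ((Nat.dvd_of_mem_divisors hr).mul_right _) (hdvd G H hH), prod_below_eq]
  have hall : ∀ᵐ ω ∂μ, ∀ r ∈ (primesBelowProd Q).divisors, Tendsto (fun n : ℕ =>
      (∑ j ∈ Finset.range n, siftInd H₁ (below G₁ Q) r (incr η 0 j ω)
        * siftInd H₂ (below G₂ Q) r (Y j ω)) / (n : ℝ)) atTop
      (𝓝 (periodMean R (siftInd H₁ (below G₁ Q) r) * periodMean R (siftInd H₂ (below G₂ Q) r))) :=
    (ae_ball_iff (Finset.countable_toSet _)).2 fun r hr =>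
      h.ae_tendsto_periodic h0 h1 hR (hp _ _ hH₁ r hr) (hp _ _ hH₂ r hr) hY
  filter_upwards [hall] with ω hω
  have hsum := tendsto_finsetSum (primesBelowProd Q).divisors fun r hr =>
    (hω r hr).const_mul (ArithmeticFunction.moebius r : ℝ)
  have elim : ∑ r ∈ (primesBelowProd Q).divisors, (ArithmeticFunction.moebius r : ℝ)
        * ((1 / r * partialDensity G₁ H₁ Q r) * (1 / r * partialDensity G₂ H₂ Q r))
      = ∑ r ∈ (primesBelowProd Q).divisors, (ArithmeticFunction.moebius r : ℝ)
        * (periodMean R (siftInd H₁ (below G₁ Q) r) * periodMean R (siftInd H₂ (below G₂ Q) r)) := by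
    refine Finset.sum_congr rfl fun r hr => ?_
    by_cases hsq : Squarefree r
    · rw [hmean _ _ hG₁ hH₁ r hr hsq, hmean _ _ hG₂ hH₂ r hr hsq]
    · simp [ArithmeticFunction.moebius_eq_zero_of_not_squarefree hsq]
  rw [elim]
  refine hsum.congr fun n => ?_
  simp_rw [truncInd]
  rw [Finset.sum_comm, Finset.sum_div]
  refine Finset.sum_congr rfl fun r _ => ?_
  rw [← Finset.mul_sum, mul_div_assoc]

/-- The order of limits matters: `Q` is fixed first, so that `d Q` and `e Q` are close to their
limits, and then `n → ∞` removes `u Q n`. -/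
lemma tendsto_of_approx {a : ℕ → ℝ} {t u : ℕ → ℕ → ℝ} {d e : ℕ → ℝ} {L : ℝ}
    (h1 : ∀ Q n, a n ≤ t Q n) (h2 : ∀ Q n, t Q n ≤ a n + (e Q + u Q n))
    (ht : ∀ Q, Tendsto (t Q) atTop (𝓝 (d Q))) (hu : ∀ Q, Tendsto (u Q) atTop (𝓝 0))
    (hd : Tendsto d atTop (𝓝 L)) (he : Tendsto e atTop (𝓝 0)) : Tendsto a atTop (𝓝 L) := by
  rw [tendsto_order]
  constructor
  · intro b hb
    have h3 : Tendsto (fun Q => d Q - e Q) atTop (𝓝 L) := by simpa using hd.sub he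
    obtain ⟨Q, hQ⟩ := (h3.eventually_const_lt hb).exists
    have h4 : Tendsto (fun n => t Q n - (e Q + u Q n)) atTop (𝓝 (d Q - (e Q + 0))) :=
      (ht Q).sub ((hu Q).const_add (e Q))
    rw [add_zero] at h4
    filter_upwards [h4.eventually_const_lt hQ] with n hn
    linarith [h2 Q n]
  · intro b hb
    obtain ⟨Q, hQ⟩ := (hd.eventually_lt_const hb).exists
    filter_upwards [(ht Q).eventually_lt_const hQ] with n hn
    exact (h1 Q n).trans_lt hn

/-- The complementary sequence counts the steps in the other direction. -/
lemma IsBernoulliSeq.compl (h : IsBernoulliSeq α η μ) :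
    IsBernoulliSeq (1 - α) (fun i ω => 1 - η i ω) μ where
  meas i := measurable_from_top.comp (h.meas i)
  indep := h.indep.comp (fun _ x => 1 - x) fun _ => measurable_from_top
  le_one i ω := Nat.sub_le _ _
  mean i := by
    have e : ∀ ω, ((1 - η i ω : ℕ) : ℝ) = 1 - (η i ω : ℝ) := fun ω => by
      rw [Nat.cast_sub (h.le_one i ω), Nat.cast_one]
    simp_rw [e]
    rw [integral_sub (integrable_const _), h.mean, integral_const]
    · simp
    · refine integrable_of_abs_le (measurable_from_top.comp (h.meas i)) (C := 1) fun ω => ?_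
      rw [abs_of_nonneg (Nat.cast_nonneg _)]
      exact_mod_cast h.le_one i ω

omit [IsProbabilityMeasure μ] in
lemma IsBernoulliSeq.incr_add_incr_compl (h : IsBernoulliSeq α η μ) (j : ℕ) (ω : Ω) :
    incr η 0 j ω + incr (fun i ω => 1 - η i ω) 0 j ω = j := by
  rw [incr, incr, ← Finset.sum_add_distrib,
    Finset.sum_congr rfl fun i _ => Nat.add_sub_cancel' (h.le_one i ω)]
  simp

theorem IsBernoulliSeq.ae_tendsto_visInd (h : IsBernoulliSeq α η μ) (h0 : 0 < α) (h1 : α < 1)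
    (hG₁ : G₁.Pairwise Nat.Coprime) (hG₂ : G₂.Pairwise Nat.Coprime) (hH₁ : Admissible G₁ H₁)
    (hH₂ : Admissible G₂ H₂) (hS₁ : Summable (recipInd G₁)) (hS₂ : Summable (recipInd G₂)) :
    ∀ᵐ ω ∂μ, Tendsto (fun n : ℕ => (∑ j ∈ Finset.range n, visInd G₁ G₂ H₁ H₂
      (incr η 0 j ω, incr (fun i ω => 1 - η i ω) 0 j ω)) / (n : ℝ)) atTop
      (𝓝 (sieveConst G₁ H₁ * sieveConst G₂ H₂ * visConst G₁ G₂ H₁ H₂)) := by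
  have h0' : 0 < 1 - α := sub_pos.2 h1
  have h1' : 1 - α < 1 := by linarith
  have hY := h.incr_add_incr_compl
  -- The exceptional null set depends on `Q`; countably many are merged. The second coordinate is a
  -- Bernoulli walk with parameter `1 - α`, so the exit bound applies to it too.
  have A1 : ∀ᵐ ω ∂μ, ∀ Q, _ :=
    ae_all_iff.2 fun Q => h.ae_tendsto_truncInd h0 h1 hG₁ hG₂ hH₁ hH₂ hY Q
  have A2 : ∀ᵐ ω ∂μ, ∀ Q, _ := ae_all_iff.2 fun Q =>
    h.ae_avg_le h0 h1 (tailInd_nonneg G₁ H₁ Q) (tailInd_le_one G₁ H₁ Q)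
  have A3 : ∀ᵐ ω ∂μ, ∀ Q, _ := ae_all_iff.2 fun Q =>
    h.compl.ae_avg_le h0' h1' (tailInd_nonneg G₂ H₂ Q) (tailInd_le_one G₂ H₂ Q)
  have A4 : ∀ᵐ ω ∂μ, ∀ Q, _ := ae_all_iff.2 fun Q => h.ae_avg_commonInd_le h0 h1 Q
  filter_upwards [A1, A2, A3, A4] with ω ht hB₁ hB₂ hB₃
  choose u₁ hu₁ hle₁ using hB₁
  choose u₂ hu₂ hle₂ using hB₂
  choose u₃ hu₃ hle₃ using hB₃
  choose v₁ hv₁ hd₁ using avg_tailInd_le hH₁ hS₁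
  choose v₂ hv₂ hd₂ using avg_tailInd_le hH₂ hS₂
  refine tendsto_of_approx (e := fun Q => 2 * H₁.card * recipTail G₁ Q / α
      + 2 * H₂.card * recipTail G₂ Q / (1 - α) + sqTail Q)
    (u := fun Q n => v₁ Q n / α + u₁ Q n + (v₂ Q n / (1 - α) + u₂ Q n) + u₃ Q n + 1 / (n : ℝ))
    (fun Q n => ?_) (fun Q n => ?_) ht (fun Q => ?_) ?_ ?_
  · exact div_le_div_of_nonneg_right (Finset.sum_le_sum fun j _ => visInd_le_truncInd _ _ _ _ _ _ _)
      (Nat.cast_nonneg _)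
  · have hs := div_le_div_of_nonneg_right (Finset.sum_le_sum fun j (_ : j ∈ Finset.range n) =>
      truncInd_le G₁ G₂ H₁ H₂ Q (hY j ω)) (Nat.cast_nonneg (α := ℝ) n)
    simp only [Finset.sum_add_distrib, add_div] at hs
    have hz : (∑ j ∈ Finset.range n, if j = 0 then (1 : ℝ) else 0) / n ≤ 1 / n := by
      refine div_le_div_of_nonneg_right ?_ (Nat.cast_nonneg _)
      rw [Finset.sum_ite_eq']
      split_ifs <;> norm_num
    have a1 := hle₁ Q n
    have a2 := hle₂ Q n
    have a3 := hle₃ Q n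
    have b1 := div_le_div_of_nonneg_right (hd₁ Q n) h0.le
    have b2 := div_le_div_of_nonneg_right (hd₂ Q n) h0'.le
    rw [add_div] at b1 b2
    linarith
  · simpa using (((((hv₁ Q).div_const α).add (hu₁ Q)).add
      (((hv₂ Q).div_const (1 - α)).add (hu₂ Q))).add (hu₃ Q)).add
      tendsto_one_div_atTop_nhds_zero_nat
  · exact tendsto_sum_partialDensity hG₁ hG₂ hH₁ hH₂ hS₁ hS₂ primesBelowProd_ne_zero
      fun r hr => eventually_dvd_primesBelowProd hr
  · simpa using ((((tendsto_recipTail G₁).const_mul (2 * (H₁.card : ℝ))).div_const α).add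
      (((tendsto_recipTail G₂).const_mul (2 * (H₂.card : ℝ))).div_const (1 - α))).add tendsto_sqTail

lemma tendsto_avg_Icc {a : ℕ → ℝ} {L : ℝ}
    (h : Tendsto (fun n : ℕ => (∑ j ∈ Finset.range n, a j) / (n : ℝ)) atTop (𝓝 L)) :
    Tendsto (fun n : ℕ => (∑ j ∈ Finset.Icc 1 n, a j) / (n : ℝ)) atTop (𝓝 L) := by
  have h1 := h.comp (tendsto_add_atTop_nat 1)
  have h2 : Tendsto (fun n : ℕ => 1 + 1 / (n : ℝ)) atTop (𝓝 1) := by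
    simpa using tendsto_one_div_atTop_nhds_zero_nat.const_add (1 : ℝ)
  have h3 := (h1.mul h2).sub (tendsto_const_div_atTop_nhds_zero_nat (a 0))
  rw [mul_one, sub_zero] at h3
  refine h3.congr' ?_
  filter_upwards [eventually_ge_atTop 1] with n hn
  have hn' : (n : ℝ) ≠ 0 := by
    have : 0 < n := hn
    positivity
  have hn1 : (n : ℝ) + 1 ≠ 0 := by positivity
  have e : ∑ j ∈ Finset.range (n + 1), a j = a 0 + ∑ j ∈ Finset.Icc 1 n, a j := by
    rw [Finset.range_eq_Ico, Finset.sum_eq_sum_Ico_succ_bot (Nat.succ_pos n)]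
    rfl
  simp only [Function.comp_apply, e, Nat.cast_add, Nat.cast_one]
  field_simp
  ring

/-- An `α`-random walk is almost surely given by a Bernoulli sequence and its complement. -/
lemma IsAlphaWalk.exists_bernoulli {P : ℕ → Ω → ℕ × ℕ} (hP : IsAlphaWalk α P μ) (h0 : 0 < α)
    (h1 : α < 1) : ∃ η : ℕ → Ω → ℕ, IsBernoulliSeq α η μ ∧
      ∀ᵐ ω ∂μ, ∀ j, P j ω = (incr η 0 j ω, incr (fun i ω => 1 - η i ω) 0 j ω) := by
  obtain ⟨ξ, hm, hind, hα, hα', hP0, hPs⟩ := hP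
  let f : ℕ × ℕ → ℕ := fun p => if p = (1, 0) then 1 else 0
  have hf : Measurable f := Measurable.of_discrete
  refine ⟨fun i ω => f (ξ i ω), ⟨fun i => hf.comp (hm i), hind.comp (fun _ => f) fun _ => hf,
    fun i ω => ?_, fun i => ?_⟩, ?_⟩
  · simp only [f]
    split_ifs <;> norm_num
  · have hs : MeasurableSet {ω | ξ i ω = (1, 0)} := hm i (measurableSet_singleton (1, 0))
    have e : (fun ω => (f (ξ i ω) : ℝ)) = {ω | ξ i ω = (1, 0)}.indicator 1 := by
      ext ω
      simp [f, Set.indicator_apply]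
    rw [e, integral_indicator_one hs, measureReal_def, hα, ENNReal.toReal_ofReal h0.le]
  · have hstep : ∀ᵐ ω ∂μ, ∀ i, ξ i ω = (1, 0) ∨ ξ i ω = (0, 1) := by
      refine ae_all_iff.2 fun i => ?_
      have hs : MeasurableSet {ω | ξ i ω = (1, 0)} := hm i (measurableSet_singleton (1, 0))
      have hs' : MeasurableSet {ω | ξ i ω = (0, 1)} := hm i (measurableSet_singleton (0, 1))
      have hd : Disjoint {ω | ξ i ω = (1, 0)} {ω | ξ i ω = (0, 1)} := by
        rw [Set.disjoint_left]
        intro ω ha hb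
        have : ((1, 0) : ℕ × ℕ) = (0, 1) := Eq.trans (Eq.symm ha) hb
        simp at this
      have hu := measure_union (μ := μ) hd hs'
      rw [hα, hα', ← ENNReal.ofReal_add h0.le (sub_pos.2 h1).le, add_sub_cancel,
        ENNReal.ofReal_one] at hu
      exact (prob_compl_eq_zero_iff (hs.union hs')).2 hu
    filter_upwards [hstep] with ω hω j
    induction j with
    | zero => simp [hP0, incr]
    | succ j ih =>
      have e : ∀ η : ℕ → Ω → ℕ, incr η 0 (j + 1) ω = incr η 0 j ω + η j ω := fun η => by
        rw [incr, Finset.sum_Ico_succ_top (Nat.zero_le _)]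
        rfl
      rw [hPs, ih, e, e]
      rcases hω j with h | h <;> simp [h, f]

end Limit

end SievedWalk

theorem theorem1p8
    (G₁ G₂ : Set ℕ) (H₁ H₂ : Finset ℤ)
    (hG₁ : G₁.Pairwise Nat.Coprime) (hG₂ : G₂.Pairwise Nat.Coprime)
    (hH₁ : SievedWalk.Admissible G₁ H₁) (hH₂ : SievedWalk.Admissible G₂ H₂)
    (A ε : ℝ) (hA : 1 ≤ A) (hε0 : 0 < ε) (hε1 : ε < 1)
    (θ₁ θ₂ : ℝ) (hθ₁0 : 0 < θ₁) (hθ₁1 : θ₁ < 1) (hθ₂0 : 0 < θ₂) (hθ₂1 : θ₂ < 1)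
    (hA₁ : SievedWalk.ConditionA θ₁ A ε (SievedWalk.truncProducts G₁ A))
    (hA₂ : SievedWalk.ConditionA θ₂ A ε (SievedWalk.truncProducts G₂ A))
    (hc₃ : SievedWalk.visConst G₁ G₂ H₁ H₂ ≠ 0)
    {Ω : Type*} [MeasurableSpace Ω] (μ : Measure Ω) [IsProbabilityMeasure μ]
    (α : ℝ) (hα0 : 0 < α) (hα1 : α < 1)
    (P : ℕ → Ω → ℕ × ℕ) (hP : SievedWalk.IsAlphaWalk α P μ) :
    Multipliable (fun g : G₁ => 1 - (SievedWalk.nu H₁ g : ℝ) / ((g : ℕ) : ℝ)) ∧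
    Multipliable (fun g : G₂ => 1 - (SievedWalk.nu H₂ g : ℝ) / ((g : ℕ) : ℝ)) ∧
    Summable (SievedWalk.visTerm G₁ G₂ H₁ H₂) ∧
    ∀ᵐ ω ∂μ, Tendsto
      (fun n : ℕ => SievedWalk.visitProportion (SievedWalk.sievedVisible G₁ G₂ H₁ H₂) P n ω)
      atTop
      (𝓝 (SievedWalk.sieveConst G₁ H₁ * SievedWalk.sieveConst G₂ H₂ *
        SievedWalk.visConst G₁ G₂ H₁ H₂)) := by
  -- Condition A enters through the convergence of `∑ 1/g` over each set of moduli.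
  have hS₁ := hA₁.summable_recipInd hA hε1 hθ₁0 hθ₁1
  have hS₂ := hA₂.summable_recipInd hA hε1 hθ₂0 hθ₂1
  refine ⟨SievedWalk.multipliable_sieveConst hS₁, SievedWalk.multipliable_sieveConst hS₂,
    SievedWalk.summable_visTerm hG₁ hG₂ hH₁ hH₂ hS₁ hS₂, ?_⟩
  obtain ⟨η, hη, hPη⟩ := hP.exists_bernoulli hα0 hα1
  filter_upwards [hη.ae_tendsto_visInd hα0 hα1 hG₁ hG₂ hH₁ hH₂ hS₁ hS₂, hPη] with ω hω hPω
  simp_rw [← hPω] at hω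
  exact SievedWalk.tendsto_avg_Icc hω
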